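/- Let $T_1,T_2,\dots$ be independent, identically distributed random variables, almost surely positive, with $T$ a generic copy, and suppose $E[T^3]<\infty$. Put $\lambda = 1/E[T]$ and $\sigma_T^2=\operatorname{var} T$. Let $t_0=0$ and $t_n=T_1+\cdots+T_n$ for $n\ge 1$, and for $t\ge 0$ let $N(t)=\#\{n\ge 0: t_n\le t\}$ (so the renewal at time $0$ is counted) and $R(t)=T_1+\cdots+T_{N(t)}-t$, the residual time at $t$ to the next renewal. Suppose that the function $t\mapsto E[R(t)]-\tfrac12\lambda E[T^2]$ is directly Riemann integrable on $[0,\infty)$. Here a function $g\ge 0$ on $[0,\infty)$ is directly Riemann integrable if the sums $h\sum_{n\ge0}\sup_{[nh,(n+1)h)}g$ and $h\sum_{n\ge0}\inf_{[nh,(n+1)h)}g$ converge, as $h\downarrow 0$, to the same finite limit, and a real-valued function is directly Riemann integrable if its positive and negative parts both are. Then $\operatorname{var} N(t)$ is finite for every $t\ge0$, and, as $t\to\infty$, $$\operatorname{var} N(t)=\lambda^3\sigma_T^2\,t-\tfrac23\lambda^3E[T^3]+\tfrac54\lambda^4\big(E[T^2]\big)^2-\tfrac12\lambda^2E[T^2]+o(1).$$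 -/

import Mathlib

open MeasureTheory ProbabilityTheory Filter Topology
open scoped ENNReal NNReal

noncomputable section

namespace Renewal

variable {Ω : Type*}

/-- Counting times of a non-delayed renewal process: `t₀ = 0` and `tₙ = T₁ + ⋯ + Tₙ`.
Lifetimes are indexed from `0`, so `T i` is the `(i + 1)`-st lifetime. -/
def countingTime (T : ℕ → Ω → ℝ) (n : ℕ) (ω : Ω) : ℝ :=
  ∑ i ∈ Finset.range n, T i ω

/-- The counting process `N(t) = #{n ≥ 0 : tₙ ≤ t}`. The counting time `t₀ = 0` is counted, so
`N(0) = 1`. When the lifetimes are independent, identically distributed and almost surely positive,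
the set is finite almost surely; on the exceptional null event `Set.ncard` may return `0`. -/
def countingProcess (T : ℕ → Ω → ℝ) (t : ℝ) (ω : Ω) : ℕ :=
  {n : ℕ | countingTime T n ω ≤ t}.ncard

/-- The residual time `R(t) = T₁ + ⋯ + T_{N(t)} - t` to the next counting instant after `t`. -/
def residualTime (T : ℕ → Ω → ℝ) (t : ℝ) (ω : Ω) : ℝ :=
  countingTime T (countingProcess T t ω) ω - t

/-- The `n`-th cell `[nh, (n+1)h)` of the partition of `[0, ∞)` with mesh `h`. -/
def cell (h : ℝ) (n : ℕ) : Set ℝ :=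
  Set.Ico (n * h) ((n + 1) * h)

/-- Upper Riemann sum over all of `[0, ∞)`, mesh `h`, of a nonnegative function. -/
def upperSum (g : ℝ → ℝ≥0∞) (h : ℝ) : ℝ≥0∞ :=
  ∑' n : ℕ, ENNReal.ofReal h * ⨆ t ∈ cell h n, g t

/-- Lower Riemann sum over all of `[0, ∞)`, mesh `h`, of a nonnegative function. -/
def lowerSum (g : ℝ → ℝ≥0∞) (h : ℝ) : ℝ≥0∞ :=
  ∑' n : ℕ, ENNReal.ofReal h * ⨅ t ∈ cell h n, g t

/-- Direct Riemann integrability on `[0, ∞)` of a nonnegative function: the upper and the lower sums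
over the infinite partitions tend to one and the same finite limit as the mesh tends to `0`. -/
def DirectlyRiemannIntegrableNonneg (g : ℝ → ℝ≥0∞) : Prop :=
  ∃ L : ℝ≥0, Tendsto (upperSum g) (𝓝[>] 0) (𝓝 (L : ℝ≥0∞)) ∧
    Tendsto (lowerSum g) (𝓝[>] 0) (𝓝 (L : ℝ≥0∞))

/-- A real function is directly Riemann integrable on `[0, ∞)` if its positive part and its negative
part are. -/
def DirectlyRiemannIntegrable (f : ℝ → ℝ) : Prop :=
  DirectlyRiemannIntegrableNonneg (fun t => ENNReal.ofReal (f t)) ∧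
    DirectlyRiemannIntegrableNonneg (fun t => ENNReal.ofReal (-f t))

end Renewal

end

namespace Renewal

open Set

/-! Let `F` be the law of the lifetimes, m and m₂ its first two moments, U = ∑ F^{*n}, and V(t) =
U((-∞, t]). Since tₙ ≤ t exactly when n < N(t), E[N] = V, and N(N+1) = ∑_{n<N} 2(n+1) gives
E[N(N+1)] = 2 U*V. Hence var N = 2 U*V - V - V² (`integral_countingProcess_mul_succ`).

Wald's identity gives E[R(t)] = m V(t) - t. With r = m₂/(2m), the hypothesis says that g(t) = m V(t)
- t - r (`excess`) is directly Riemann integrable. So g → 0, and differencing V yields Blackwell's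
theorem for U; the key renewal theorem follows (`tendsto_lintegral_shift`).

Substituting V = (g + t + r)/m cancels the t² terms in var N and leaves λ³σ²t plus constants and
terms in U*g, g, t g and g², plus a tail moment convolved with U. Two facts remain: the limit of U*g
and t g → 0. Both come from a renewal equation for t g(t) (`mul_excess_eq`). Its solution converges
to some c that is affine in lim U*g, and direct Riemann integrability rules out g ~ c/t with c ≠ 0,
because the harmonic series diverges. So c = 0, which gives t g → 0 and fixes lim U*g without
integrating g. -/

/-- The `n`-fold convolution power of a measure on the line. -/
noncomputable def convPow (F : Measure ℝ) : ℕ → Measure ℝ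
  | 0 => Measure.dirac 0
  | n + 1 => (convPow F n).conv F

/-- The renewal measure `∑ₙ F^{*n}`, including the atom at `0`. -/
noncomputable def renewalMeasure (F : Measure ℝ) : Measure ℝ :=
  Measure.sum (convPow F)

/-! ### The renewal measure, its local finiteness and the renewal equation. -/

section Basic

variable {F : Measure ℝ} [IsProbabilityMeasure F]

instance isProbabilityMeasure_convPow (n : ℕ) : IsProbabilityMeasure (convPow F n) := by
  induction n with
  | zero => exact Measure.dirac.isProbabilityMeasure
  | succ n ih => rw [convPow]; infer_instance

instance sFinite_renewalMeasure : SFinite (renewalMeasure F) := by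
  unfold renewalMeasure; infer_instance

theorem convPow_add (m n : ℕ) :
    convPow F (m + n) = (convPow F m).conv (convPow F n) := by
  induction n with
  | zero => simp [convPow, Measure.conv_dirac_zero]
  | succ n ih => rw [← add_assoc, convPow, ih, convPow, Measure.conv_assoc]

theorem renewalMeasure_eq_dirac_add_conv :
    renewalMeasure F = Measure.dirac 0 + (renewalMeasure F).conv F := by
  refine Measure.ext_of_lintegral _ fun f hf => ?_
  rw [lintegral_add_measure, Measure.lintegral_conv hf, renewalMeasure, lintegral_sum_measure,
    lintegral_sum_measure, tsum_eq_zero_add' ENNReal.summable]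
  simp only [convPow]
  congr 1
  exact tsum_congr fun n => Measure.lintegral_conv hf

theorem convPow_Iio_zero (hF : F (Iic 0) = 0) (n : ℕ) : convPow F n (Iio 0) = 0 := by
  induction n with
  | zero => simp [convPow]
  | succ n ih =>
    rw [convPow, ← lintegral_indicator_one measurableSet_Iio,
      Measure.lintegral_conv (measurable_one.indicator measurableSet_Iio)]
    have h1 : ∀ᵐ x ∂(convPow F n), 0 ≤ x := by
      rw [ae_iff]; convert ih using 2; ext; simp
    have h2 : ∀ᵐ x ∂F, 0 < x := by
      rw [ae_iff]; convert hF using 2; ext; simp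
    refine (lintegral_congr_ae (h1.mono fun x hx => ?_)).trans (lintegral_zero)
    refine (lintegral_congr_ae (h2.mono fun y hy => ?_)).trans (lintegral_zero)
    simp [indicator, (by linarith : ¬ x + y < 0)]

theorem ae_nonneg_renewalMeasure (hF : F (Iic 0) = 0) : ∀ᵐ x ∂(renewalMeasure F), 0 ≤ x := by
  rw [renewalMeasure, Measure.ae_sum_iff]
  intro n
  rw [ae_iff]; convert convPow_Iio_zero hF n using 2; ext; simp

omit [IsProbabilityMeasure F] in
theorem ae_pos (hF : F (Iic 0) = 0) : ∀ᵐ x ∂F, 0 < x := by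
  rw [ae_iff]; convert hF using 2; ext; simp

theorem lintegral_exp_neg_convPow (n : ℕ) :
    ∫⁻ x, ENNReal.ofReal (Real.exp (-x)) ∂(convPow F n)
      = (∫⁻ x, ENNReal.ofReal (Real.exp (-x)) ∂F) ^ n := by
  have hm : Measurable fun x : ℝ => ENNReal.ofReal (Real.exp (-x)) := by fun_prop
  induction n with
  | zero => simp [convPow]
  | succ n ih =>
    rw [convPow, Measure.lintegral_conv hm, pow_succ, ← ih]
    simp_rw [neg_add, Real.exp_add, ENNReal.ofReal_mul (Real.exp_pos _).le]
    simp_rw [lintegral_const_mul _ hm]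
    rw [lintegral_mul_const _ hm]

theorem lintegral_exp_neg_lt_one (hF : F (Iic 0) = 0) :
    ∫⁻ x, ENNReal.ofReal (Real.exp (-x)) ∂F < 1 := by
  have hm : Measurable fun x : ℝ => ENNReal.ofReal (Real.exp (-x)) := by fun_prop
  have h : ∀ᵐ x ∂F, ENNReal.ofReal (Real.exp (-x)) < 1 := by
    filter_upwards [ae_pos hF] with x hx
    rw [ENNReal.ofReal_lt_one, Real.exp_lt_one_iff]; linarith
  have hle : ∫⁻ x, ENNReal.ofReal (Real.exp (-x)) ∂F ≤ 1 := by
    calc _ ≤ ∫⁻ _, 1 ∂F := lintegral_mono_ae (h.mono fun _ hx => hx.le)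
      _ = 1 := by simp
  calc _ < ∫⁻ _, 1 ∂F := lintegral_strict_mono (IsProbabilityMeasure.ne_zero F) (by fun_prop)
          (ne_top_of_le_ne_top ENNReal.one_ne_top hle) h
    _ = 1 := by simp

/-- Chernoff bound: the indicator of x ≤ t is at most e^{t-x}, and the Laplace transforms at 1 of
the convolution powers form a geometric series with ratio q < 1, since lifetimes are positive. -/
theorem renewalMeasure_Iic_lt_top (hF : F (Iic 0) = 0) (t : ℝ) :
    renewalMeasure F (Iic t) < ∞ := by
  set q := ∫⁻ x, ENNReal.ofReal (Real.exp (-x)) ∂F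
  have hm : Measurable fun x : ℝ => ENNReal.ofReal (Real.exp (-x)) := by fun_prop
  calc renewalMeasure F (Iic t) = ∫⁻ x, (Iic t).indicator 1 x ∂(renewalMeasure F) :=
        (lintegral_indicator_one measurableSet_Iic).symm
    _ ≤ ∫⁻ x, ENNReal.ofReal (Real.exp t) * ENNReal.ofReal (Real.exp (-x)) ∂(renewalMeasure F) := by
        refine lintegral_mono fun x => ?_
        by_cases hx : x ≤ t
        · rw [← ENNReal.ofReal_mul (Real.exp_pos _).le, ← Real.exp_add]
          simp only [indicator, mem_Iic, hx, if_true, Pi.one_apply, ENNReal.one_le_ofReal]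
          apply Real.one_le_exp; linarith
        · simp [indicator, hx]
    _ = ENNReal.ofReal (Real.exp t) * (1 - q)⁻¹ := by
        rw [lintegral_const_mul _ hm, renewalMeasure, lintegral_sum_measure]
        simp_rw [lintegral_exp_neg_convPow]
        rw [ENNReal.tsum_geometric]
    _ < ∞ := by
        refine ENNReal.mul_lt_top ENNReal.ofReal_lt_top ?_
        rw [ENNReal.inv_lt_top]
        exact tsub_pos_of_lt (lintegral_exp_neg_lt_one hF)

/-- The renewal function `V(t) = U((-∞, t])`. -/
noncomputable def renewalFunction (F : Measure ℝ) (t : ℝ) : ℝ := (renewalMeasure F).real (Iic t)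

omit [IsProbabilityMeasure F] in
theorem renewalFunction_nonneg (t : ℝ) : 0 ≤ renewalFunction F t := measureReal_nonneg

theorem renewalFunction_mono (hF : F (Iic 0) = 0) : Monotone (renewalFunction F) := fun _ t h =>
  measureReal_mono (Iic_subset_Iic.2 h) (renewalMeasure_Iic_lt_top hF t).ne

theorem renewalFunction_of_neg (hF : F (Iic 0) = 0) {t : ℝ} (ht : t < 0) :
    renewalFunction F t = 0 := by
  rw [renewalFunction, measureReal_def, measure_mono_null (Iic_subset_Iio.2 ht), ENNReal.toReal_zero]
  have := ae_nonneg_renewalMeasure hF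
  rw [ae_iff] at this; convert this using 2; ext; simp

/-- Functions are extended by 0 to negative arguments, so only s in [0, t] contributes, and U is
finite there. -/
theorem integrable_shift_of_bounded (hF : F (Iic 0) = 0) {f : ℝ → ℝ} (hf : Measurable f)
    (h0 : ∀ x < 0, f x = 0) {t B : ℝ} (hB : ∀ x ∈ Icc 0 t, |f x| ≤ B) :
    Integrable (fun s => f (t - s)) (renewalMeasure F) := by
  have : Integrable ((Iic t).indicator fun _ => B) (renewalMeasure F) :=
    (integrable_indicator_iff measurableSet_Iic).2
      (integrableOn_const (renewalMeasure_Iic_lt_top hF t).ne)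
  refine this.mono' (hf.comp (measurable_const.sub measurable_id)).aestronglyMeasurable ?_
  filter_upwards [ae_nonneg_renewalMeasure hF] with s hs
  by_cases hst : s ≤ t
  · simpa [indicator, hst] using hB (t - s) ⟨by linarith, by linarith⟩
  · simp [indicator, hst, h0 (t - s) (by linarith)]

theorem integrable_shift_of_bounded' (hF : F (Iic 0) = 0) {f : ℝ → ℝ} (hf : Measurable f)
    (h0 : ∀ x < 0, f x = 0) {t B : ℝ} (hB : ∀ x ∈ Icc 0 t, |f x| ≤ B) :
    Integrable (fun s => f (t - s)) F := by
  have : Integrable (fun _ : ℝ => |B|) F := integrable_const _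
  refine this.mono' (hf.comp (measurable_const.sub measurable_id)).aestronglyMeasurable ?_
  filter_upwards [ae_pos hF] with s hs
  by_cases hst : s ≤ t
  · exact (hB (t - s) ⟨by linarith, by linarith⟩).trans (le_abs_self B)
  · simp [h0 (t - s) (by linarith)]

/-- A locally bounded solution of the renewal equation `φ = y + φ * F` is `y * U`. -/
theorem eq_integral_renewalMeasure (hF : F (Iic 0) = 0) {φ : ℝ → ℝ} (hφ : Measurable φ)
    (h0 : ∀ x < 0, φ x = 0) {t B : ℝ} (hB : ∀ x ∈ Icc 0 t, |φ x| ≤ B) :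
    Integrable (fun s => φ (t - s) - ∫ x, φ (t - s - x) ∂F) (renewalMeasure F) ∧
    φ t = ∫ s, (φ (t - s) - ∫ x, φ (t - s - x) ∂F) ∂(renewalMeasure F) := by
  have hint := integrable_shift_of_bounded hF hφ h0 hB
  have hint' := hint
  rw [renewalMeasure_eq_dirac_add_conv, integrable_add_measure] at hint'
  have hc := hint'.2
  have hp' : Integrable (fun p : ℝ × ℝ => φ (t - (p.1 + p.2))) ((renewalMeasure F).prod F) := by
    exact Integrable.comp_measurable (f := fun p : ℝ × ℝ => p.1 + p.2) (g := fun s => φ (t - s)) hc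
      (by fun_prop)
  have hc' : Integrable (fun s => ∫ x, φ (t - s - x) ∂F) (renewalMeasure F) := by
    simpa only [sub_sub] using hp'.integral_prod_left
  refine ⟨hint.sub hc', ?_⟩
  rw [integral_sub hint hc']
  -- U = δ₀ + U*F gives U*φ = φ + U*(φ*F); all terms are finite and may be subtracted.
  have : ∫ s, φ (t - s) ∂(renewalMeasure F)
      = φ t + ∫ s, ∫ x, φ (t - s - x) ∂F ∂(renewalMeasure F) := by
    conv_lhs => rw [renewalMeasure_eq_dirac_add_conv]
    rw [integral_add_measure hint'.1 hint'.2, integral_dirac, integral_conv hc]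
    simp [sub_sub]
  linarith

theorem renewalFunction_eq (hF : F (Iic 0) = 0) (t : ℝ) :
    renewalFunction F t = (Ici 0).indicator 1 t + ∫ x, renewalFunction F (t - x) ∂F := by
  have hm : Measurable ((Ici (0 : ℝ)).indicator (1 : ℝ → ℝ)) :=
    measurable_one.indicator measurableSet_Ici
  have hV : ∀ t, renewalFunction F t
      = ∫ s, (Ici (0 : ℝ)).indicator (1 : ℝ → ℝ) (t - s) ∂(renewalMeasure F) := by
    intro t
    rw [renewalFunction, ← integral_indicator_one measurableSet_Iic]
    congr 1; ext s; simp [indicator]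
  have hb : ∀ t, ∀ x ∈ Icc 0 t, |(Ici (0 : ℝ)).indicator (1 : ℝ → ℝ) x| ≤ 1 := by
    intro t x hx; simp [indicator, hx.1]
  have hint := integrable_shift_of_bounded hF hm (by simp +contextual [indicator]) (hb t)
  rw [renewalMeasure_eq_dirac_add_conv, integrable_add_measure] at hint
  rw [hV t]
  conv_lhs => rw [renewalMeasure_eq_dirac_add_conv]
  -- Commuting the convolution puts `F` outside, so that the inner integral over U is V(t - x).
  rw [integral_add_measure hint.1 hint.2, integral_dirac, Measure.conv_comm,
    integral_conv (by rw [Measure.conv_comm]; exact hint.2)]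
  simp_rw [hV, sub_sub, sub_zero]

end Basic

/-! ### The key renewal theorem for nonnegative functions. -/

section KeyRenewal

variable {U : Measure ℝ} {lam : ℝ}

/-- Far out the limit bounds the window; before that, the mass of a half-line does. -/
theorem exists_bound_measure_Ioc (hfin : ∀ t, U (Iic t) < ∞) {h : ℝ} {c : ℝ≥0∞} (hc : c ≠ ∞)
    (hU : Tendsto (fun t => U (Ioc (t - h) t)) atTop (𝓝 c)) :
    ∃ C : ℝ≥0∞, C ≠ ∞ ∧ ∀ t, U (Ioc (t - h) t) ≤ C := by
  have h1 : ∀ᶠ t in atTop, U (Ioc (t - h) t) < c + 1 :=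
    hU.eventually (gt_mem_nhds (ENNReal.lt_add_right hc one_ne_zero))
  obtain ⟨t₀, ht₀⟩ := eventually_atTop.1 h1
  refine ⟨max (c + 1) (U (Iic t₀)), ?_, fun t => ?_⟩
  · exact (max_lt (ENNReal.add_lt_top.2 ⟨hc.lt_top, ENNReal.one_lt_top⟩) (hfin t₀)).ne
  · rcases le_total t₀ t with ht | ht
    · exact (ht₀ t ht).le.trans (le_max_left _ _)
    · exact (measure_mono (Ioc_subset_Iic_self.trans (Iic_subset_Iic.2 ht))).trans
        (le_max_right _ _)

/-- The intervals are those on which t - s runs through the cells of mesh h. -/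
theorem lintegral_shift_eq_tsum {f : ℝ → ℝ≥0∞} (h0 : ∀ x < 0, f x = 0) {h : ℝ} (hh : 0 < h)
    (t : ℝ) :
    ∫⁻ s, f (t - s) ∂U
      = ∑' n : ℕ, ∫⁻ s in Ioc (t - (n + 1) * h) (t - n * h), f (t - s) ∂U := by
  have hd : Pairwise (Function.onFun Disjoint
      fun n : ℕ => Ioc (t - ((n : ℝ) + 1) * h) (t - n * h)) := by
    refine (pairwise_disjoint_on _).2 fun m n hmn => ?_
    refine Set.disjoint_left.2 fun x hx hx' => ?_
    have : (m : ℝ) + 1 ≤ n := by exact_mod_cast hmn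
    nlinarith [hx.1, hx'.2]
  have hun : ⋃ n : ℕ, Ioc (t - ((n : ℝ) + 1) * h) (t - n * h) = Iic t := by
    ext s
    simp only [mem_iUnion, mem_Ioc, mem_Iic]
    constructor
    · rintro ⟨n, -, hn⟩
      have : 0 ≤ (n : ℝ) * h := by positivity
      linarith
    · intro hs
      refine ⟨⌊(t - s) / h⌋₊, ?_, ?_⟩
      · have := Nat.lt_floor_add_one ((t - s) / h)
        rw [div_lt_iff₀ hh] at this
        linarith
      · have := Nat.floor_le (div_nonneg (sub_nonneg.2 hs) hh.le)
        rw [le_div_iff₀ hh] at this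
        linarith
  rw [← lintegral_iUnion (fun n => measurableSet_Ioc) hd, hun]
  refine (setLIntegral_eq_of_support_subset ?_).symm
  intro s hs
  by_contra hst
  exact hs (h0 _ (by simp only [mem_Iic, not_le] at hst; linarith))

theorem lintegral_shift_le_tsum {f : ℝ → ℝ≥0∞} (h0 : ∀ x < 0, f x = 0) {h : ℝ} (hh : 0 < h)
    (t : ℝ) :
    ∫⁻ s, f (t - s) ∂U
      ≤ ∑' n : ℕ, (⨆ x ∈ cell h n, f x) * U (Ioc (t - (n + 1) * h) (t - n * h)) := by
  rw [lintegral_shift_eq_tsum h0 hh]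
  refine ENNReal.tsum_le_tsum fun n => ?_
  rw [← setLIntegral_const]
  refine setLIntegral_mono' measurableSet_Ioc fun s hs => ?_
  exact le_biSup f (⟨by linarith [hs.2], by linarith [hs.1]⟩ : t - s ∈ cell h n)

theorem tsum_le_lintegral_shift {f : ℝ → ℝ≥0∞} (h0 : ∀ x < 0, f x = 0) {h : ℝ} (hh : 0 < h)
    (t : ℝ) :
    ∑' n : ℕ, (⨅ x ∈ cell h n, f x) * U (Ioc (t - (n + 1) * h) (t - n * h))
      ≤ ∫⁻ s, f (t - s) ∂U := by
  rw [lintegral_shift_eq_tsum h0 hh]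
  refine ENNReal.tsum_le_tsum fun n => ?_
  rw [← setLIntegral_const]
  refine setLIntegral_mono' measurableSet_Ioc fun s hs => ?_
  exact biInf_le f (⟨by linarith [hs.2], by linarith [hs.1]⟩ : t - s ∈ cell h n)

/-- Dominated convergence for counting measure, the windows having uniformly bounded mass. -/
theorem tendsto_tsum_mul_measure_Ioc (hfin : ∀ t, U (Iic t) < ∞) {h : ℝ} {c : ℝ≥0∞} (hc : c ≠ ∞)
    (hU : Tendsto (fun t => U (Ioc (t - h) t)) atTop (𝓝 c)) {a : ℕ → ℝ≥0∞}
    (ha : ∑' n, a n ≠ ∞) :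
    Tendsto (fun t : ℝ => ∑' n : ℕ, a n * U (Ioc (t - (n + 1) * h) (t - n * h))) atTop
      (𝓝 (∑' n, a n * c)) := by
  obtain ⟨C, hC, hb⟩ := exists_bound_measure_Ioc hfin hc hU
  have hshift : ∀ (t : ℝ) (n : ℕ), U (Ioc (t - (n + 1) * h) (t - n * h))
      = U (Ioc ((t - n * h) - h) (t - n * h)) := by
    intro t n; congr 2; ring
  simp_rw [← lintegral_count, hshift]
  refine tendsto_lintegral_filter_of_dominated_convergence (fun n => a n * C)
    (Eventually.of_forall fun t => measurable_from_top)
    (Eventually.of_forall fun t => Eventually.of_forall fun n => by gcongr; exact hb _) ?_ ?_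
  · rw [lintegral_count, ENNReal.tsum_mul_right]
    exact ENNReal.mul_ne_top ha hC
  · refine Eventually.of_forall fun n => ?_
    refine ENNReal.Tendsto.const_mul ?_ (Or.inr (ENNReal.ne_top_of_tsum_ne_top ha n))
    exact hU.comp (tendsto_atTop_add_const_right _ _ tendsto_id)

theorem tsum_mul_ofReal_eq (hlam : 0 ≤ lam) (h : ℝ) (a : ℕ → ℝ≥0∞) :
    ∑' n, a n * ENNReal.ofReal (lam * h)
      = ENNReal.ofReal lam * ∑' n, ENNReal.ofReal h * a n := by
  rw [ENNReal.tsum_mul_right, ENNReal.tsum_mul_left, ENNReal.ofReal_mul hlam]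
  ring

theorem lowerSum_le_upperSum (f : ℝ → ℝ≥0∞) {h : ℝ} (hh : 0 < h) :
    lowerSum f h ≤ upperSum f h := by
  refine ENNReal.tsum_le_tsum fun n => ?_
  gcongr
  have : (n : ℝ) * h ∈ cell h n := ⟨le_rfl, by nlinarith⟩
  exact (biInf_le f this).trans (le_biSup f this)

theorem eventually_upperSum_lt_top {f : ℝ → ℝ≥0∞} {L : ℝ≥0}
    (hup : Tendsto (upperSum f) (𝓝[>] 0) (𝓝 (L : ℝ≥0∞))) :
    ∀ᶠ h in 𝓝[>] (0 : ℝ), 0 < h ∧ upperSum f h < ∞ := by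
  filter_upwards [self_mem_nhdsWithin, hup.eventually (gt_mem_nhds ENNReal.coe_lt_top)]
    with h hh hlt using ⟨hh, hlt⟩

theorem tsum_ne_top_of_tsum_ofReal_mul_lt_top {h : ℝ} {a : ℕ → ℝ≥0∞} (hh : 0 < h)
    (ha : ∑' n, ENNReal.ofReal h * a n < ∞) : ∑' n, a n ≠ ∞ := by
  intro hne
  rw [ENNReal.tsum_mul_left, hne, ENNReal.mul_top (by simpa using hh)] at ha
  exact ha.ne rfl

/-- The key renewal theorem, for a measure `U` that satisfies Blackwell's theorem. -/
theorem tendsto_lintegral_shift (hlam : 0 ≤ lam) (hfin : ∀ t, U (Iic t) < ∞)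
    (hU : ∀ h > 0, Tendsto (fun t => U (Ioc (t - h) t)) atTop (𝓝 (ENNReal.ofReal (lam * h))))
    {f : ℝ → ℝ≥0∞} (h0 : ∀ x < 0, f x = 0) {L : ℝ≥0}
    (hup : Tendsto (upperSum f) (𝓝[>] 0) (𝓝 (L : ℝ≥0∞)))
    (hlo : Tendsto (lowerSum f) (𝓝[>] 0) (𝓝 (L : ℝ≥0∞))) :
    Tendsto (fun t => ∫⁻ s, f (t - s) ∂U) atTop (𝓝 (ENNReal.ofReal lam * L)) := by
  have hev := eventually_upperSum_lt_top hup
  -- At fixed mesh the lower sum bounds the liminf and the upper sum the limsup; only afterwards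
  -- does h tend to 0.
  refine tendsto_of_le_liminf_of_limsup_le ?_ ?_
  · refine le_of_tendsto (ENNReal.Tendsto.const_mul hlo (Or.inr ENNReal.ofReal_ne_top)) ?_
    filter_upwards [hev] with h hh
    have ht := tendsto_tsum_mul_measure_Ioc hfin ENNReal.ofReal_ne_top (hU h hh.1)
      (tsum_ne_top_of_tsum_ofReal_mul_lt_top hh.1 ((lowerSum_le_upperSum f hh.1).trans_lt hh.2))
    rw [tsum_mul_ofReal_eq hlam] at ht
    refine ht.liminf_eq.symm.le.trans (liminf_le_liminf (Eventually.of_forall fun t => ?_))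
    exact tsum_le_lintegral_shift h0 hh.1 t
  · refine ge_of_tendsto (ENNReal.Tendsto.const_mul hup (Or.inr ENNReal.ofReal_ne_top)) ?_
    filter_upwards [hev] with h hh
    have ht := tendsto_tsum_mul_measure_Ioc hfin ENNReal.ofReal_ne_top (hU h hh.1)
      (tsum_ne_top_of_tsum_ofReal_mul_lt_top hh.1 hh.2)
    rw [tsum_mul_ofReal_eq hlam] at ht
    refine (limsup_le_limsup (Eventually.of_forall fun t => ?_)).trans ht.limsup_eq.le
    exact lintegral_shift_le_tsum h0 hh.1 t

/-- Uniformity in t supplies the dominating function for the limit of the last term of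
`mul_excess_eq`. -/
theorem exists_bound_lintegral_shift (hfin : ∀ t, U (Iic t) < ∞)
    (hU : ∀ h > 0, Tendsto (fun t => U (Ioc (t - h) t)) atTop (𝓝 (ENNReal.ofReal (lam * h))))
    {f : ℝ → ℝ≥0∞} (h0 : ∀ x < 0, f x = 0) {L : ℝ≥0}
    (hup : Tendsto (upperSum f) (𝓝[>] 0) (𝓝 (L : ℝ≥0∞))) :
    ∃ B : ℝ≥0∞, B ≠ ∞ ∧ ∀ t, ∫⁻ s, f (t - s) ∂U ≤ B := by
  obtain ⟨h, hh, hfinite⟩ := (eventually_upperSum_lt_top hup).exists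
  obtain ⟨C, hC, hb⟩ := exists_bound_measure_Ioc hfin ENNReal.ofReal_ne_top (hU h hh)
  refine ⟨(∑' n : ℕ, ⨆ x ∈ cell h n, f x) * C, ENNReal.mul_ne_top ?_ hC, fun t => ?_⟩
  · exact tsum_ne_top_of_tsum_ofReal_mul_lt_top hh hfinite
  · refine (lintegral_shift_le_tsum h0 hh t).trans ?_
    rw [← ENNReal.tsum_mul_right]
    refine ENNReal.tsum_le_tsum fun n => ?_
    gcongr
    rw [show t - ((n : ℝ) + 1) * h = t - n * h - h by ring]
    exact hb _

/-- A directly Riemann integrable function vanishes at infinity. -/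
theorem tendsto_zero_of_upperSum {f : ℝ → ℝ≥0∞} {L : ℝ≥0}
    (hup : Tendsto (upperSum f) (𝓝[>] 0) (𝓝 (L : ℝ≥0∞))) : Tendsto f atTop (𝓝 0) := by
  obtain ⟨h, hh, hfinite⟩ := (eventually_upperSum_lt_top hup).exists
  have ht := ENNReal.tendsto_atTop_zero_of_tsum_ne_top
    (f := fun n : ℕ => ⨆ x ∈ cell h n, f x) (tsum_ne_top_of_tsum_ofReal_mul_lt_top hh hfinite)
  have hfl : Tendsto (fun t : ℝ => ⌊t / h⌋₊) atTop atTop :=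
    tendsto_nat_floor_atTop.comp (tendsto_id.atTop_div_const hh)
  refine tendsto_of_tendsto_of_tendsto_of_le_of_le' tendsto_const_nhds (ht.comp hfl)
    (Eventually.of_forall fun _ => zero_le) ?_
  filter_upwards [eventually_ge_atTop 0] with t ht0
  refine le_biSup f (?_ : t ∈ cell h ⌊t / h⌋₊)
  constructor
  · have := Nat.floor_le (div_nonneg ht0 hh.le)
    rwa [le_div_iff₀ hh] at this
  · have := Nat.lt_floor_add_one (t / h)
    rwa [div_lt_iff₀ hh] at this

/-- A directly Riemann integrable function cannot dominate a multiple of `1 / t` near infinity. -/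
theorem not_eventually_div_le_of_upperSum {f : ℝ → ℝ≥0∞} {L : ℝ≥0}
    (hup : Tendsto (upperSum f) (𝓝[>] 0) (𝓝 (L : ℝ≥0∞))) :
    ¬ ∃ c : ℝ, 0 < c ∧ ∀ᶠ t in atTop, ENNReal.ofReal (c / t) ≤ f t := by
  rintro ⟨c, hc, hev'⟩
  obtain ⟨h, hh, hfinite⟩ := (eventually_upperSum_lt_top hup).exists
  have hne : ∑' n : ℕ, (⨆ x ∈ cell h n, f x) ≠ ∞ :=
    tsum_ne_top_of_tsum_ofReal_mul_lt_top hh hfinite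
  have hs := ENNReal.summable_toReal hne
  -- The left endpoint nh lies in its cell, so the suprema dominate a multiple of the harmonic
  -- series.
  have hlow : ∀ᶠ n : ℕ in atTop, c / h * (1 / (n : ℝ)) ≤ (⨆ x ∈ cell h n, f x).toReal := by
    have hn : Tendsto (fun n : ℕ => (n : ℝ) * h) atTop atTop :=
      tendsto_natCast_atTop_atTop.atTop_mul_const hh
    filter_upwards [hn.eventually hev'] with n hn
    have hmem : (n : ℝ) * h ∈ cell h n := ⟨le_rfl, by nlinarith⟩
    have := hn.trans (le_biSup f hmem)
    rw [ENNReal.ofReal_le_iff_le_toReal (ENNReal.ne_top_of_tsum_ne_top hne n)] at this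
    refine le_trans (le_of_eq ?_) this
    by_cases h0 : (n : ℝ) = 0
    · simp [h0]
    · field_simp
  have hsum : Summable fun n : ℕ => c / h * (1 / (n : ℝ)) := by
    refine Summable.of_norm_bounded_eventually_nat hs ?_
    filter_upwards [hlow] with n hn
    rwa [Real.norm_of_nonneg (by positivity)]
  rw [summable_mul_left_iff (by positivity)] at hsum
  exact Real.not_summable_one_div_natCast hsum

/-- An integrable antitone function on `[0, ∞)` is directly Riemann integrable. -/
theorem tendsto_sums_of_antitoneOn {f : ℝ → ℝ≥0∞} (hf : AntitoneOn f (Ici 0)) (h0 : f 0 ≠ ∞)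
    {L : ℝ≥0} (hL : ∫⁻ x in Ici 0, f x = L) :
    Tendsto (upperSum f) (𝓝[>] 0) (𝓝 (L : ℝ≥0∞)) ∧
      Tendsto (lowerSum f) (𝓝[>] 0) (𝓝 (L : ℝ≥0∞)) := by
  have hpart : ∀ {h : ℝ}, 0 < h → ∫⁻ x in Ici 0, f x
      = ∑' n : ℕ, ∫⁻ x in cell h n, f x := by
    intro h hh
    have hd : Pairwise (Function.onFun Disjoint (cell h)) := by
      refine (pairwise_disjoint_on _).2 fun m n hmn => ?_
      refine Set.disjoint_left.2 fun x hx hx' => ?_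
      have : (m : ℝ) + 1 ≤ n := by exact_mod_cast hmn
      nlinarith [hx.2, hx'.1]
    rw [← lintegral_iUnion (s := cell h) (fun n => measurableSet_Ico) hd]
    congr 2
    ext x
    simp only [mem_iUnion, cell, mem_Ico, mem_Ici]
    constructor
    · intro hx
      refine ⟨⌊x / h⌋₊, ?_, ?_⟩
      · have := Nat.floor_le (div_nonneg hx hh.le)
        rwa [le_div_iff₀ hh] at this
      · have := Nat.lt_floor_add_one (x / h)
        rwa [div_lt_iff₀ hh] at this
    · rintro ⟨n, hn, -⟩
      exact le_trans (by positivity) hn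
  have hvol : ∀ (h : ℝ) (n : ℕ), volume (cell h n) = ENNReal.ofReal h := by
    intro h n; rw [cell, Real.volume_Ico]; congr 1; ring
  have hI_up : ∀ {h : ℝ}, 0 < h → (L : ℝ≥0∞) ≤ upperSum f h := by
    intro h hh
    rw [← hL, hpart hh]
    refine ENNReal.tsum_le_tsum fun n => ?_
    rw [mul_comm, ← hvol h n, ← setLIntegral_const]
    exact setLIntegral_mono' measurableSet_Ico fun s hs => le_biSup f hs
  have hlo_I : ∀ {h : ℝ}, 0 < h → lowerSum f h ≤ L := by
    intro h hh
    rw [← hL, hpart hh]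
    refine ENNReal.tsum_le_tsum fun n => ?_
    rw [mul_comm, ← hvol h n, ← setLIntegral_const]
    exact setLIntegral_mono' measurableSet_Ico fun s hs => biInf_le f hs
  -- By monotonicity the supremum on a cell is at most the infimum on the preceding one; only cell 0
  -- has no predecessor, and it costs h f(0).
  have hul : ∀ {h : ℝ}, 0 < h → upperSum f h ≤ ENNReal.ofReal h * f 0 + lowerSum f h := by
    intro h hh
    rw [upperSum, tsum_eq_zero_add' ENNReal.summable, lowerSum]
    gcongr with n
    · refine iSup₂_le fun x hx => hf (mem_Ici.2 le_rfl) ?_ ?_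
      · simpa [cell] using hx.1
      · simpa [cell] using hx.1
    · refine iSup₂_le fun x hx => le_iInf₂ fun y hy => ?_
      have hy0 : 0 ≤ y := le_trans (by positivity) hy.1
      have hxy : y ≤ x := by
        have := hx.1; push_cast at this; linarith [hy.2]
      exact hf hy0 (hy0.trans hxy) hxy
  have hpos : ∀ᶠ h in 𝓝[>] (0 : ℝ), 0 < h := self_mem_nhdsWithin
  have hz : Tendsto (fun h : ℝ => ENNReal.ofReal h * f 0) (𝓝[>] 0) (𝓝 0) := by
    have : Tendsto (fun h : ℝ => ENNReal.ofReal h * f 0) (𝓝[>] 0)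
        (𝓝 (ENNReal.ofReal 0 * f 0)) :=
      ENNReal.Tendsto.mul_const
        ((ENNReal.continuous_ofReal.tendsto 0).mono_left nhdsWithin_le_nhds) (Or.inr h0)
    simpa using this
  constructor
  · refine tendsto_of_tendsto_of_tendsto_of_le_of_le' tendsto_const_nhds
      (h := fun h => ENNReal.ofReal h * f 0 + L) ?_ (hpos.mono fun h => hI_up)
      (hpos.mono fun h hh => (hul hh).trans (by gcongr; exact hlo_I hh))
    simpa using hz.add_const (L : ℝ≥0∞)
  · refine tendsto_of_tendsto_of_tendsto_of_le_of_le'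
      (g := fun h => L - ENNReal.ofReal h * f 0) ?_ tendsto_const_nhds
      (hpos.mono fun h hh => ?_) (hpos.mono fun h => hlo_I)
    · simpa using ENNReal.Tendsto.sub tendsto_const_nhds hz (Or.inl ENNReal.coe_ne_top)
    · exact tsub_le_iff_left.2 ((hI_up hh).trans (hul hh))

end KeyRenewal

/-! ### Tail moments, the forcing terms of the renewal equations. -/

section Tail

/-- The tail moment `E[T ^ i (T - x) ^ j; T > x]` for `x ≥ 0`, extended by `0`. -/
noncomputable def tailMoment (F : Measure ℝ) (i j : ℕ) (x : ℝ) : ℝ :=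
  (Ici 0).indicator (fun x => ∫ τ, (Ioi x).indicator (fun τ => τ ^ i * (τ - x) ^ j) τ ∂F) x

variable {F : Measure ℝ} [IsProbabilityMeasure F]

theorem integrable_pow_of_le_three (hF : F (Iic 0) = 0) (h3 : Integrable (fun x => x ^ 3) F)
    {k : ℕ} (hk : k ≤ 3) : Integrable (fun x => x ^ k) F := by
  refine ((integrable_const (1 : ℝ)).add h3).mono' (by fun_prop) ?_
  filter_upwards [ae_pos hF] with x hx
  rw [Real.norm_of_nonneg (by positivity)]
  rcases le_total x 1 with h | h
  · have := pow_le_one₀ hx.le h (n := k)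
    have : 0 ≤ x ^ 3 := by positivity
    simp only [Pi.add_apply]; linarith
  · have := pow_le_pow_right₀ h hk
    simp only [Pi.add_apply]; linarith

theorem measurable_tailKernel (i j : ℕ) : Measurable fun p : ℝ × ℝ =>
    (Ioi p.1).indicator (fun τ => τ ^ i * (τ - p.1) ^ j) p.2 := by
  have : (fun p : ℝ × ℝ => (Ioi p.1).indicator (fun τ => τ ^ i * (τ - p.1) ^ j) p.2)
      = {p : ℝ × ℝ | p.1 < p.2}.indicator (fun p => p.2 ^ i * (p.2 - p.1) ^ j) := by
    ext p; simp [indicator]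
  rw [this]
  exact Measurable.indicator (by fun_prop) (measurableSet_lt measurable_fst measurable_snd)

theorem measurable_tailMoment (i j : ℕ) : Measurable (tailMoment F i j) := by
  refine Measurable.indicator ?_ measurableSet_Ici
  exact ((measurable_tailKernel i j).stronglyMeasurable.integral_prod_right (ν := F)).measurable

theorem tailKernel_nonneg {i j : ℕ} {x τ : ℝ} (hx : 0 ≤ x) :
    0 ≤ (Ioi x).indicator (fun τ => τ ^ i * (τ - x) ^ j) τ := by
  refine indicator_nonneg (fun τ hτ => ?_) τ
  have : x < τ := hτ
  exact mul_nonneg (pow_nonneg (by linarith) _) (pow_nonneg (by linarith) _)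

theorem tailKernel_antitone {i j : ℕ} {x y τ : ℝ} (hx : 0 ≤ x) (hxy : x ≤ y) :
    (Ioi y).indicator (fun τ => τ ^ i * (τ - y) ^ j) τ
      ≤ (Ioi x).indicator (fun τ => τ ^ i * (τ - x) ^ j) τ := by
  by_cases h : y < τ
  · have h' : x < τ := by linarith
    simp only [indicator, mem_Ioi, h, h', if_true]
    have : 0 ≤ τ := by linarith
    have : 0 ≤ τ - y := by linarith
    gcongr
  · simpa [indicator, h] using tailKernel_nonneg (i := i) (j := j) (τ := τ) hx

theorem integrable_tailKernel (hF : F (Iic 0) = 0) (h3 : Integrable (fun x => x ^ 3) F) {i j : ℕ}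
    (hij : i + j ≤ 3) {x : ℝ} (hx : 0 ≤ x) :
    Integrable (fun τ => (Ioi x).indicator (fun τ => τ ^ i * (τ - x) ^ j) τ) F := by
  refine (integrable_pow_of_le_three hF h3 hij).mono'
    ((measurable_tailKernel i j).comp (measurable_const.prodMk measurable_id)).aestronglyMeasurable ?_
  filter_upwards [ae_pos hF] with τ hτ
  rw [Real.norm_of_nonneg (tailKernel_nonneg hx)]
  refine (tailKernel_antitone le_rfl hx).trans (le_of_eq ?_)
  simp [indicator, hτ, pow_add]

omit [IsProbabilityMeasure F] in
theorem tailMoment_of_nonneg {i j : ℕ} {x : ℝ} (hx : 0 ≤ x) : tailMoment F i j x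
    = ∫ τ, (Ioi x).indicator (fun τ => τ ^ i * (τ - x) ^ j) τ ∂F := by
  simp [tailMoment, indicator, hx]

omit [IsProbabilityMeasure F] in
theorem tailMoment_of_neg {i j : ℕ} {x : ℝ} (hx : x < 0) : tailMoment F i j x = 0 := by
  simp [tailMoment, indicator, hx]

omit [IsProbabilityMeasure F] in
theorem tailMoment_nonneg {i j : ℕ} (x : ℝ) : 0 ≤ tailMoment F i j x :=
  indicator_nonneg (fun _ hx => integral_nonneg fun _ => tailKernel_nonneg hx) x

theorem tailMoment_antitoneOn (hF : F (Iic 0) = 0) (h3 : Integrable (fun x => x ^ 3) F) {i j : ℕ}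
    (hij : i + j ≤ 3) : AntitoneOn (tailMoment F i j) (Ici 0) := by
  intro x hx y hy hxy
  rw [tailMoment_of_nonneg hx, tailMoment_of_nonneg hy]
  exact integral_mono (integrable_tailKernel hF h3 hij hy) (integrable_tailKernel hF h3 hij hx)
    fun τ => tailKernel_antitone hx hxy

theorem lintegral_tailKernel (i j : ℕ) {τ : ℝ} (hτ : 0 < τ) :
    ∫⁻ x in Ici 0, ENNReal.ofReal ((Ioi x).indicator (fun τ => τ ^ i * (τ - x) ^ j) τ)
      = ENNReal.ofReal (τ ^ (i + j + 1) / (j + 1)) := by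
  have h1 : ∫⁻ x in Ici 0, ENNReal.ofReal ((Ioi x).indicator (fun τ => τ ^ i * (τ - x) ^ j) τ)
      = ∫⁻ x in Ico 0 τ, ENNReal.ofReal (τ ^ i * (τ - x) ^ j) := by
    rw [← lintegral_indicator measurableSet_Ici, ← lintegral_indicator measurableSet_Ico]
    congr 1; ext x
    by_cases hx : 0 ≤ x <;> by_cases hxτ : x < τ <;> simp [indicator, hx, hxτ]
  have hc : Continuous fun x : ℝ => τ ^ i * (τ - x) ^ j := by fun_prop
  rw [h1, ← ofReal_integral_eq_lintegral_ofReal]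
  · rw [integral_Ico_eq_integral_Ioc, ← intervalIntegral.integral_of_le hτ.le,
      intervalIntegral.integral_const_mul,
      intervalIntegral.integral_comp_sub_left (fun x => x ^ j) τ, integral_pow]
    congr 1
    simp
    ring
  · exact (hc.integrableOn_Icc).mono_set Ico_subset_Icc_self
  · filter_upwards [ae_restrict_mem measurableSet_Ico] with x hx
    exact mul_nonneg (pow_nonneg hτ.le _) (pow_nonneg (by linarith [hx.2]) _)

/-- Tonelli: integrating over x before τ leaves ∫₀^τ τ^i (τ - x)^j dx. -/
theorem lintegral_tailMoment (hF : F (Iic 0) = 0) (h3 : Integrable (fun x => x ^ 3) F) {i j : ℕ}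
    (hij : i + j + 1 ≤ 3) :
    ∫⁻ x in Ici 0, ENNReal.ofReal (tailMoment F i j x)
      = ENNReal.ofReal ((∫ τ, τ ^ (i + j + 1) ∂F) / (j + 1)) := by
  have h1 : ∫⁻ x in Ici 0, ENNReal.ofReal (tailMoment F i j x) = ∫⁻ x in Ici 0, ∫⁻ τ,
      ENNReal.ofReal ((Ioi x).indicator (fun τ => τ ^ i * (τ - x) ^ j) τ) ∂F := by
    refine setLIntegral_congr_fun measurableSet_Ici fun x hx => ?_
    rw [tailMoment_of_nonneg hx, ofReal_integral_eq_lintegral_ofReal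
      (integrable_tailKernel hF h3 (by omega) hx)
      (Eventually.of_forall fun τ => tailKernel_nonneg hx)]
  rw [h1, lintegral_lintegral_swap (measurable_tailKernel i j).ennreal_ofReal.aemeasurable,
    ← integral_div, ofReal_integral_eq_lintegral_ofReal]
  · refine lintegral_congr_ae ?_
    filter_upwards [ae_pos hF] with τ hτ using lintegral_tailKernel i j hτ
  · exact (integrable_pow_of_le_three hF h3 hij).div_const _
  · filter_upwards [ae_pos hF] with τ hτ
    positivity

theorem integrable_tailMoment_shift (hF : F (Iic 0) = 0) (h3 : Integrable (fun x => x ^ 3) F)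
    {i j : ℕ} (hij : i + j ≤ 3) (t : ℝ) :
    Integrable (fun s => tailMoment F i j (t - s)) (renewalMeasure F) :=
  integrable_shift_of_bounded hF (measurable_tailMoment i j) (fun _ => tailMoment_of_neg)
    (B := tailMoment F i j 0) fun x hx => by
      rw [abs_of_nonneg (tailMoment_nonneg x)]
      exact tailMoment_antitoneOn hF h3 hij (mem_Ici.2 le_rfl) hx.1 hx.1

/-- Tail moments are antitone and integrable, hence directly Riemann integrable, so the key renewal
theorem applies. -/
theorem tendsto_integral_tailMoment_shift (hF : F (Iic 0) = 0)
    (h3 : Integrable (fun x => x ^ 3) F) {lam : ℝ} (hlam : 0 ≤ lam)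
    (hU : ∀ h > 0, Tendsto (fun t => renewalMeasure F (Ioc (t - h) t)) atTop
      (𝓝 (ENNReal.ofReal (lam * h)))) {i j : ℕ} (hij : i + j + 1 ≤ 3) :
    Tendsto (fun t => ∫ s, tailMoment F i j (t - s) ∂(renewalMeasure F)) atTop
      (𝓝 (lam * ((∫ τ, τ ^ (i + j + 1) ∂F) / (j + 1)))) := by
  have hnn : 0 ≤ (∫ τ, τ ^ (i + j + 1) ∂F) / (j + 1) := by
    refine div_nonneg (integral_nonneg_of_ae ?_) (by positivity)
    filter_upwards [ae_pos hF] with τ hτ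
    positivity
  have hs := tendsto_sums_of_antitoneOn (f := fun x => ENNReal.ofReal (tailMoment F i j x))
    (fun x hx y hy hxy => ENNReal.ofReal_le_ofReal
      (tailMoment_antitoneOn hF h3 (by omega) hx hy hxy))
    ENNReal.ofReal_ne_top (lintegral_tailMoment hF h3 hij)
  have ht := tendsto_lintegral_shift hlam (renewalMeasure_Iic_lt_top hF) hU
    (fun x hx => by simp [tailMoment_of_neg hx]) hs.1 hs.2
  have := (ENNReal.tendsto_toReal (ENNReal.mul_ne_top ENNReal.ofReal_ne_top ENNReal.coe_ne_top)).comp ht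
  rw [ENNReal.toReal_mul, ENNReal.toReal_ofReal hlam, ENNReal.coe_toReal,
    Real.coe_toNNReal _ hnn] at this
  refine this.congr fun t => ?_
  rw [integral_eq_lintegral_of_nonneg_ae (Eventually.of_forall fun s => tailMoment_nonneg _)
    (integrable_tailMoment_shift hF h3 (by omega) t).aestronglyMeasurable]
  rfl

/-- Splitting of an integrand at the level `x`. -/
theorem integral_max_sub (hF : F (Iic 0) = 0) (h3 : Integrable (fun x => x ^ 3) F) {x : ℝ}
    (hx : 0 ≤ x) : ∫ τ, max (x - τ) 0 ∂F = x - ∫ τ, τ ∂F + tailMoment F 0 1 x := by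
  have hi : Integrable (fun τ => τ) F := by
    simpa using integrable_pow_of_le_three hF h3 (k := 1) (by norm_num)
  rw [tailMoment_of_nonneg hx]
  have h1 : ∀ τ, max (x - τ) 0
      = x - τ + (Ioi x).indicator (fun τ => τ ^ 0 * (τ - x) ^ 1) τ := by
    intro τ
    by_cases h : x < τ
    · simp [indicator, h, h.le]
    · simp [indicator, h, not_lt.1 h]
  simp_rw [h1]
  have hi' : Integrable (fun τ => x - τ) F := (integrable_const x).sub hi
  rw [integral_add hi' (integrable_tailKernel hF h3 (by norm_num) hx),
    integral_sub (integrable_const x) hi]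
  simp

/-- The polynomial (x - τ)² is integrated over all τ and corrected on τ > x. -/
theorem integral_max_sub_sq (hF : F (Iic 0) = 0) (h3 : Integrable (fun x => x ^ 3) F) {x : ℝ}
    (hx : 0 ≤ x) : ∫ τ, max (x - τ) 0 ^ 2 ∂F
      = x ^ 2 - 2 * x * ∫ τ, τ ∂F + ∫ τ, τ ^ 2 ∂F - tailMoment F 0 2 x := by
  have hi : Integrable (fun τ => τ) F := by
    simpa using integrable_pow_of_le_three hF h3 (k := 1) (by norm_num)
  have hi2 := integrable_pow_of_le_three hF h3 (k := 2) (by norm_num)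
  rw [tailMoment_of_nonneg hx]
  have h1 : ∀ τ, max (x - τ) 0 ^ 2
      = x ^ 2 - 2 * x * τ + τ ^ 2 - (Ioi x).indicator (fun τ => τ ^ 0 * (τ - x) ^ 2) τ := by
    intro τ
    by_cases h : x < τ
    · simp [indicator, h, h.le]; ring
    · simp [indicator, h, not_lt.1 h]; ring
  simp_rw [h1]
  have hi3 : Integrable (fun τ => x ^ 2 - 2 * x * τ) F :=
    (integrable_const _).sub (hi.const_mul _)
  have hi4 : Integrable (fun τ => x ^ 2 - 2 * x * τ + τ ^ 2) F := hi3.add hi2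
  rw [integral_sub hi4 (integrable_tailKernel hF h3 (by norm_num) hx),
    integral_add hi3 hi2, integral_sub (integrable_const _) (hi.const_mul _),
    integral_const_mul]
  simp

theorem integral_indicator_Ici_sub {x : ℝ} (hx : 0 ≤ x) :
    ∫ τ, (Ici (0 : ℝ)).indicator (1 : ℝ → ℝ) (x - τ) ∂F = 1 - tailMoment F 0 0 x := by
  rw [tailMoment_of_nonneg hx]
  have h1 : ∀ τ, (Ici (0 : ℝ)).indicator (1 : ℝ → ℝ) (x - τ)
      = 1 - (Ioi x).indicator (fun τ => τ ^ 0 * (τ - x) ^ 0) τ := by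
    intro τ
    by_cases h : x < τ
    · simp [indicator, h]
    · simp [indicator, h, not_lt.1 h]
  simp_rw [h1]
  rw [integral_sub (integrable_const _)]
  · simp
  · simp only [pow_zero, mul_one]
    exact (integrable_const _).indicator measurableSet_Ioi

/-- Write x = τ - (τ - x) under the integral. This keeps the forcing terms within tail moments when
a renewal equation is multiplied by t. -/
theorem mul_tailMoment (hF : F (Iic 0) = 0) (h3 : Integrable (fun x => x ^ 3) F) {i j : ℕ}
    (hij : i + j + 1 ≤ 3) (x : ℝ) :
    x * tailMoment F i j x = tailMoment F (i + 1) j x - tailMoment F i (j + 1) x := by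
  rcases lt_or_ge x 0 with hx | hx
  · simp [tailMoment_of_neg hx]
  · simp_rw [tailMoment_of_nonneg hx]
    rw [← integral_const_mul, ← integral_sub (integrable_tailKernel hF h3 (by omega) hx)
      (integrable_tailKernel hF h3 (by omega) hx)]
    congr 1; ext τ
    by_cases h : x < τ
    · simp [indicator, h]; ring
    · simp [indicator, h]

end Tail

/-! ### Direct Riemann integrability of signed functions. -/

section SignedKeyRenewal

/-- Cells of positive mesh lie in [0, ∞), so negative arguments are irrelevant and extension by 0 is
harmless. -/
theorem upperSum_congr {f f' : ℝ → ℝ≥0∞} (hff : ∀ x, 0 ≤ x → f x = f' x) {h : ℝ} (hh : 0 < h) :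
    upperSum f h = upperSum f' h := by
  refine tsum_congr fun n => ?_
  congr 1
  exact biSup_congr fun x hx => hff x (le_trans (by positivity) hx.1)

theorem lowerSum_congr {f f' : ℝ → ℝ≥0∞} (hff : ∀ x, 0 ≤ x → f x = f' x) {h : ℝ} (hh : 0 < h) :
    lowerSum f h = lowerSum f' h := by
  refine tsum_congr fun n => ?_
  congr 1
  exact biInf_congr fun x hx => hff x (le_trans (by positivity) hx.1)

theorem DirectlyRiemannIntegrableNonneg.congr {f f' : ℝ → ℝ≥0∞}
    (hf : DirectlyRiemannIntegrableNonneg f) (hff : ∀ x, 0 ≤ x → f x = f' x) :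
    DirectlyRiemannIntegrableNonneg f' := by
  obtain ⟨L, h1, h2⟩ := hf
  refine ⟨L, h1.congr' ?_, h2.congr' ?_⟩
  · filter_upwards [self_mem_nhdsWithin] with h hh using upperSum_congr hff hh
  · filter_upwards [self_mem_nhdsWithin] with h hh using lowerSum_congr hff hh

theorem DirectlyRiemannIntegrable.congr {f f' : ℝ → ℝ} (hf : DirectlyRiemannIntegrable f)
    (hff : ∀ x, 0 ≤ x → f x = f' x) : DirectlyRiemannIntegrable f' :=
  ⟨hf.1.congr fun x hx => by rw [hff x hx], hf.2.congr fun x hx => by rw [hff x hx]⟩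

theorem DirectlyRiemannIntegrable.tendsto_zero {f : ℝ → ℝ} (hf : DirectlyRiemannIntegrable f) :
    Tendsto f atTop (𝓝 0) := by
  obtain ⟨⟨L, h1, -⟩, ⟨L', h2, -⟩⟩ := hf
  have t1 := (ENNReal.tendsto_toReal ENNReal.zero_ne_top).comp (tendsto_zero_of_upperSum h1)
  have t2 := (ENNReal.tendsto_toReal ENNReal.zero_ne_top).comp (tendsto_zero_of_upperSum h2)
  have := t1.sub t2
  simp only [ENNReal.toReal_zero, sub_zero] at this
  refine this.congr fun x => ?_
  simp only [Function.comp, ENNReal.toReal_ofReal']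
  rcases le_total 0 (f x) with h | h <;> simp [h]

/-- If `t f(t)` has a limit and `f` is directly Riemann integrable then the limit is `0`. -/
theorem DirectlyRiemannIntegrable.eq_zero_of_tendsto_mul {f : ℝ → ℝ}
    (hf : DirectlyRiemannIntegrable f) {c : ℝ} (hc : Tendsto (fun t => t * f t) atTop (𝓝 c)) :
    c = 0 := by
  -- A limit c > 0 would force f(t) ≥ c/(2t) eventually. The claim is applied to f and to -f.
  have key : ∀ {f : ℝ → ℝ} {c : ℝ}, DirectlyRiemannIntegrableNonneg (fun t => ENNReal.ofReal (f t)) →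
      Tendsto (fun t => t * f t) atTop (𝓝 c) → c ≤ 0 := by
    rintro f c ⟨L, h1, -⟩ hc
    by_contra! hpos
    refine not_eventually_div_le_of_upperSum h1 ⟨c / 2, by positivity, ?_⟩
    filter_upwards [hc.eventually (lt_mem_nhds (half_lt_self hpos)), eventually_gt_atTop 0]
      with t ht ht0
    refine ENNReal.ofReal_le_ofReal ?_
    rw [div_le_iff₀ ht0]
    linarith
  refine le_antisymm (key hf.1 hc) ?_
  have := key (f := fun t => - f t) (c := -c) hf.2 (by simpa using hc.neg)
  linarith

/-- The positive and negative parts are treated separately. Only the existence of G is recorded; its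
value is found later. -/
theorem DirectlyRiemannIntegrable.exists_tendsto_integral_shift {U : Measure ℝ} {lam : ℝ}
    (hlam : 0 ≤ lam) (hfin : ∀ t, U (Iic t) < ∞)
    (hU : ∀ h > 0, Tendsto (fun t => U (Ioc (t - h) t)) atTop (𝓝 (ENNReal.ofReal (lam * h))))
    {f : ℝ → ℝ} (hf : DirectlyRiemannIntegrable f) (h0 : ∀ x < 0, f x = 0)
    (hint : ∀ t, Integrable (fun s => f (t - s)) U) :
    (∃ G, Tendsto (fun t => ∫ s, f (t - s) ∂U) atTop (𝓝 (lam * G))) ∧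
      ∃ B, ∀ t, |∫ s, f (t - s) ∂U| ≤ B := by
  obtain ⟨⟨L, hp1, hp2⟩, ⟨L', hn1, hn2⟩⟩ := hf
  have h0p : ∀ x < 0, ENNReal.ofReal (f x) = 0 := fun x hx => by simp [h0 x hx]
  have h0n : ∀ x < 0, ENNReal.ofReal (-f x) = 0 := fun x hx => by simp [h0 x hx]
  have heq : ∀ t, ∫ s, f (t - s) ∂U = (∫⁻ s, ENNReal.ofReal (f (t - s)) ∂U).toReal
      - (∫⁻ s, ENNReal.ofReal (-f (t - s)) ∂U).toReal := fun t =>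
    integral_eq_lintegral_pos_part_sub_lintegral_neg_part (hint t)
  constructor
  · refine ⟨L - L', ?_⟩
    have hne : ∀ K : ℝ≥0, ENNReal.ofReal lam * (K : ℝ≥0∞) ≠ ∞ := fun K =>
      ENNReal.mul_ne_top ENNReal.ofReal_ne_top ENNReal.coe_ne_top
    have t1 := (ENNReal.tendsto_toReal (hne L)).comp (tendsto_lintegral_shift hlam hfin hU h0p hp1 hp2)
    have t2 := (ENNReal.tendsto_toReal (hne L')).comp
      (tendsto_lintegral_shift hlam hfin hU h0n hn1 hn2)
    have := t1.sub t2
    simp only [ENNReal.toReal_mul, ENNReal.toReal_ofReal hlam, ENNReal.coe_toReal,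
      ← mul_sub] at this
    exact this.congr fun t => (heq t).symm
  · obtain ⟨B, hB, hb⟩ := exists_bound_lintegral_shift hfin hU h0p hp1
    obtain ⟨B', hB', hb'⟩ := exists_bound_lintegral_shift hfin hU h0n hn1
    refine ⟨B.toReal + B'.toReal, fun t => ?_⟩
    rw [heq t]
    refine (abs_sub _ _).trans ?_
    rw [abs_of_nonneg ENNReal.toReal_nonneg, abs_of_nonneg ENNReal.toReal_nonneg]
    exact add_le_add (ENNReal.toReal_mono hB (hb t)) (ENNReal.toReal_mono hB' (hb' t))

end SignedKeyRenewal

section Linearity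

variable {α : Type*} [MeasurableSpace α] {ν : Measure α} {f g k : α → ℝ}

theorem integral_sub_sub_eq (hf : Integrable f ν) (hg : Integrable g ν) (hk : Integrable k ν) :
    ∫ x, f x - g x - k x ∂ν = (∫ x, f x ∂ν) - (∫ x, g x ∂ν) - ∫ x, k x ∂ν := by
  rw [← integral_sub hf hg]
  exact integral_sub (hf.sub hg) hk

theorem integral_sub_add_eq (hf : Integrable f ν) (hg : Integrable g ν) (hk : Integrable k ν) :
    ∫ x, f x - g x + k x ∂ν = (∫ x, f x ∂ν) - (∫ x, g x ∂ν) + ∫ x, k x ∂ν := by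
  rw [← integral_sub hf hg]
  exact integral_add (hf.sub hg) hk

end Linearity

/-! ### The excess g, its renewal equations, and the asymptotics of the variance. -/

section Excess

/-- The excess `m V(t) - t - E[T²] / (2m)` of the expected residual time over its limit,
extended by `0` to negative arguments. -/
noncomputable def excess (F : Measure ℝ) (t : ℝ) : ℝ :=
  (Ici 0).indicator (fun t => (∫ x, x ∂F) * renewalFunction F t - t
    - (∫ x, x ^ 2 ∂F) / (2 * ∫ x, x ∂F)) t

variable {F : Measure ℝ} [IsProbabilityMeasure F]

theorem mean_pos (hF : F (Iic 0) = 0) (h3 : Integrable (fun x => x ^ 3) F) : 0 < ∫ x, x ∂F := by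
  have hi : Integrable (fun τ => τ) F := by
    simpa using integrable_pow_of_le_three hF h3 (k := 1) (by norm_num)
  rw [integral_pos_iff_support_of_nonneg_ae ((ae_pos hF).mono fun x hx => hx.le) hi]
  refine pos_iff_ne_zero.2 fun h => ?_
  have h1 : ∀ᵐ x ∂F, False := by
    have : ∀ᵐ x ∂F, x = 0 := by
      rw [ae_iff]; exact h
    filter_upwards [this, ae_pos hF] with x hx hx'
    linarith
  exact IsProbabilityMeasure.ne_zero F (by simpa using h1)

omit [IsProbabilityMeasure F] in
theorem excess_of_neg {t : ℝ} (ht : t < 0) : excess F t = 0 := by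
  simp [excess, indicator, ht]

omit [IsProbabilityMeasure F] in
theorem excess_of_nonneg {t : ℝ} (ht : 0 ≤ t) : excess F t = (∫ x, x ∂F) * renewalFunction F t - t
    - (∫ x, x ^ 2 ∂F) / (2 * ∫ x, x ∂F) := by
  simp [excess, indicator, ht]

theorem excess_eq (hF : F (Iic 0) = 0) (t : ℝ) : excess F t
    = (∫ x, x ∂F) * renewalFunction F t - max t 0
      - (∫ x, x ^ 2 ∂F) / (2 * ∫ x, x ∂F) * (Ici (0 : ℝ)).indicator (1 : ℝ → ℝ) t := by
  rcases lt_or_ge t 0 with ht | ht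
  · simp [excess_of_neg ht, renewalFunction_of_neg hF ht, indicator, ht, ht.le]
  · simp [excess_of_nonneg ht, indicator, ht]

theorem measurable_renewalFunction (hF : F (Iic 0) = 0) : Measurable (renewalFunction F) :=
  (renewalFunction_mono hF).measurable

theorem measurable_excess (hF : F (Iic 0) = 0) : Measurable (excess F) := by
  have := measurable_renewalFunction hF
  exact Measurable.indicator (by fun_prop) measurableSet_Ici

theorem exists_bound_excess (hF : F (Iic 0) = 0) (t : ℝ) :
    ∃ B, 0 ≤ B ∧ ∀ x ≤ t, |excess F x| ≤ B := by
  refine ⟨|∫ x, x ∂F| * renewalFunction F t + |t| + |(∫ x, x ^ 2 ∂F) / (2 * ∫ x, x ∂F)|,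
    add_nonneg (add_nonneg (mul_nonneg (abs_nonneg _) (renewalFunction_nonneg t)) (abs_nonneg _))
      (abs_nonneg _), fun x hx => ?_⟩
  rcases lt_or_ge x 0 with h | h
  · rw [excess_of_neg h, abs_zero]
    exact add_nonneg (add_nonneg (mul_nonneg (abs_nonneg _) (renewalFunction_nonneg t))
      (abs_nonneg _)) (abs_nonneg _)
  · rw [excess_of_nonneg h]
    refine (abs_sub _ _).trans (add_le_add_left ((abs_sub _ _).trans (add_le_add ?_ ?_)) _)
    · rw [abs_mul, abs_of_nonneg (renewalFunction_nonneg x)]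
      exact mul_le_mul_of_nonneg_left (renewalFunction_mono hF hx) (abs_nonneg _)
    · rw [abs_of_nonneg h]; exact hx.trans (le_abs_self t)

theorem integrable_excess_shift (hF : F (Iic 0) = 0) (t : ℝ) :
    Integrable (fun s => excess F (t - s)) (renewalMeasure F) := by
  obtain ⟨B, -, hB⟩ := exists_bound_excess hF t
  exact integrable_shift_of_bounded hF (measurable_excess hF) (fun _ => excess_of_neg)
    fun x hx => hB x hx.2

/-- Apply φ ↦ φ - φ*F to the three terms of `excess_eq`: the constant m from m V cancels the one
from the positive part of t, and only tails remain. -/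
theorem excess_sub_integral (hF : F (Iic 0) = 0) (h3 : Integrable (fun x => x ^ 3) F) (t : ℝ) :
    excess F t - ∫ x, excess F (t - x) ∂F = tailMoment F 0 1 t
      - (∫ x, x ^ 2 ∂F) / (2 * ∫ x, x ∂F) * tailMoment F 0 0 t := by
  rcases lt_or_ge t 0 with ht | ht
  · have : ∫ x, excess F (t - x) ∂F = 0 := by
      refine integral_eq_zero_of_ae ?_
      filter_upwards [ae_pos hF] with x hx
      exact excess_of_neg (by linarith)
    simp [this, excess_of_neg ht, tailMoment_of_neg ht]
  · have hV : Integrable (fun x => renewalFunction F (t - x)) F :=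
      integrable_shift_of_bounded' hF (measurable_renewalFunction hF)
        (fun x hx => renewalFunction_of_neg hF hx) (B := renewalFunction F t) fun x hx => by
          rw [abs_of_nonneg (renewalFunction_nonneg x)]; exact renewalFunction_mono hF hx.2
    have ha : Integrable (fun x => max (t - x) 0) F :=
      integrable_shift_of_bounded' hF (f := fun x => max x 0) (by fun_prop)
        (fun x hx => by simp [hx.le]) (B := t) fun x hx => by
          rw [max_eq_left hx.1, abs_of_nonneg hx.1]; exact hx.2
    have h1 : Integrable (fun x => (Ici (0 : ℝ)).indicator (1 : ℝ → ℝ) (t - x)) F :=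
      integrable_shift_of_bounded' hF (measurable_one.indicator measurableSet_Ici)
        (fun x hx => by simp [indicator, hx]) (B := 1) (t := t)
        fun x hx => by simp [indicator, hx.1]
    have hVe := renewalFunction_eq hF t
    simp_rw [excess_eq hF]
    rw [integral_sub_sub_eq (hV.const_mul _) ha (h1.const_mul _),
      integral_const_mul, integral_const_mul, integral_max_sub hF h3 ht,
      integral_indicator_Ici_sub ht]
    rw [max_eq_left ht]
    have : (Ici (0 : ℝ)).indicator (1 : ℝ → ℝ) t = 1 := by simp [indicator, ht]
    rw [this] at hVe ⊢
    linear_combination (∫ x, x ∂F) * hVe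

/-- Multiply `excess_sub_integral` by t and split t = (t - x) + x under the integral;
`mul_tailMoment` absorbs the factor t. -/
theorem mul_excess_sub_integral (hF : F (Iic 0) = 0) (h3 : Integrable (fun x => x ^ 3) F) (t : ℝ) :
    t * excess F t - ∫ x, (t - x) * excess F (t - x) ∂F
      = tailMoment F 1 1 t - tailMoment F 0 2 t - (∫ x, x ^ 2 ∂F) / (2 * ∫ x, x ∂F)
        * (tailMoment F 1 0 t - tailMoment F 0 1 t) + ∫ x, x * excess F (t - x) ∂F := by
  obtain ⟨B, -, hB⟩ := exists_bound_excess hF t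
  have hi : Integrable (fun τ => τ) F := by
    simpa using integrable_pow_of_le_three hF h3 (k := 1) (by norm_num)
  have hg : Integrable (fun x => excess F (t - x)) F :=
    integrable_shift_of_bounded' hF (measurable_excess hF) (fun _ => excess_of_neg)
      fun x hx => hB x hx.2
  have hm : Measurable fun x => excess F (t - x) :=
    (measurable_excess hF).comp (measurable_const.sub measurable_id)
  have hxg : Integrable (fun x => x * excess F (t - x)) F := by
    refine hi.mul_bdd (c := B) hm.aestronglyMeasurable ?_
    filter_upwards [ae_pos hF] with x hx using hB _ (by linarith)
  have e1 := mul_tailMoment hF h3 (i := 0) (j := 1) (by norm_num) t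
  have e2 := mul_tailMoment hF h3 (i := 0) (j := 0) (by norm_num) t
  have e3 := excess_sub_integral hF h3 t
  simp_rw [sub_mul]
  rw [integral_sub (hg.const_mul t) hxg, integral_const_mul]
  simp only [zero_add, one_add_one_eq_two] at e1 e2
  linear_combination t * e3 + e1 - (∫ x, x ^ 2 ∂F) / (2 * ∫ x, x ∂F) * e2

/-- Convolving the preceding equation with U, with Fubini for the last term, writes t g(t) through
quantities whose limits exist. -/
theorem mul_excess_eq (hF : F (Iic 0) = 0) (h3 : Integrable (fun x => x ^ 3) F) (t : ℝ) :
    t * excess F t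
      = (∫ s, tailMoment F 1 1 (t - s) ∂(renewalMeasure F))
        - (∫ s, tailMoment F 0 2 (t - s) ∂(renewalMeasure F))
        - (∫ x, x ^ 2 ∂F) / (2 * ∫ x, x ∂F) * ((∫ s, tailMoment F 1 0 (t - s) ∂(renewalMeasure F))
          - ∫ s, tailMoment F 0 1 (t - s) ∂(renewalMeasure F))
        + ∫ x, x * ∫ s, excess F (t - x - s) ∂(renewalMeasure F) ∂F := by
  obtain ⟨B, hB0, hB⟩ := exists_bound_excess hF t
  have hi : Integrable (fun τ => τ) F := by
    simpa using integrable_pow_of_le_three hF h3 (k := 1) (by norm_num)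
  have hm := measurable_excess hF
  have hprod : Integrable (fun p : ℝ × ℝ => p.2 * excess F (t - p.1 - p.2))
      ((renewalMeasure F).prod F) := by
    have hB' : Integrable ((Iic t).indicator fun _ => B) (renewalMeasure F) :=
      (integrable_indicator_iff measurableSet_Iic).2
        (integrableOn_const (renewalMeasure_Iic_lt_top hF t).ne)
    refine (hB'.mul_prod hi).mono' (Measurable.aestronglyMeasurable (by fun_prop)) ?_
    filter_upwards [Measure.quasiMeasurePreserving_snd.ae (ae_pos hF),
      Measure.quasiMeasurePreserving_fst.ae (ae_nonneg_renewalMeasure hF)] with p hp2 hp1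
    rw [norm_mul, Real.norm_of_nonneg hp2.le, mul_comm, Real.norm_eq_abs]
    by_cases hpt : p.1 ≤ t
    · simp only [indicator, mem_Iic, hpt, if_true]
      exact mul_le_mul_of_nonneg_right (hB _ (by linarith)) hp2.le
    · rw [excess_of_neg (by linarith)]
      simp [indicator, hpt]
  have hswap : ∫ s, ∫ x, x * excess F (t - s - x) ∂F ∂(renewalMeasure F)
      = ∫ x, x * ∫ s, excess F (t - x - s) ∂(renewalMeasure F) ∂F := by
    rw [integral_integral_swap hprod]
    simp_rw [integral_const_mul, sub_right_comm]
  have hB2 : ∀ x ∈ Icc 0 t, |x * excess F x| ≤ t * B := fun x hx => by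
    rw [abs_mul, abs_of_nonneg hx.1]
    exact mul_le_mul hx.2 (hB x hx.2) (abs_nonneg _) (hx.1.trans hx.2)
  have hsol := (eq_integral_renewalMeasure hF (φ := fun x => x * excess F x) (by fun_prop)
    (fun x hx => by simp [excess_of_neg hx]) hB2).2
  simp_rw [mul_excess_sub_integral hF h3] at hsol
  have i11 := integrable_tailMoment_shift hF h3 (i := 1) (j := 1) (by norm_num) t
  have i02 := integrable_tailMoment_shift hF h3 (i := 0) (j := 2) (by norm_num) t
  have i10 := integrable_tailMoment_shift hF h3 (i := 1) (j := 0) (by norm_num) t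
  have i01 := integrable_tailMoment_shift hF h3 (i := 0) (j := 1) (by norm_num) t
  have ii : Integrable (fun s => tailMoment F 1 1 (t - s) - tailMoment F 0 2 (t - s))
    (renewalMeasure F) := i11.sub i02
  have ii' : Integrable (fun s => tailMoment F 1 0 (t - s) - tailMoment F 0 1 (t - s))
    (renewalMeasure F) := i10.sub i01
  have ip : Integrable (fun s => ∫ x, x * excess F (t - s - x) ∂F) (renewalMeasure F) :=
    hprod.integral_prod_left
  rw [integral_sub_add_eq ii (ii'.const_mul _) ip, integral_sub i11 i02,
    integral_const_mul, integral_sub i10 i01, hswap] at hsol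
  exact hsol

/-- Blackwell's theorem, when the expected residual time converges. -/
theorem tendsto_renewalMeasure_Ioc (hF : F (Iic 0) = 0) (h3 : Integrable (fun x => x ^ 3) F)
    (hg : Tendsto (excess F) atTop (𝓝 0)) {h : ℝ} (hh : 0 < h) :
    Tendsto (fun t => renewalMeasure F (Ioc (t - h) t)) atTop
      (𝓝 (ENNReal.ofReal (1 / (∫ x, x ∂F) * h))) := by
  have hm := mean_pos hF h3
  -- Since m V(t) = t + r + g(t), the mass of the window is (h + g(t) - g(t - h))/m.
  have h1 : Tendsto (fun t => 1 / (∫ x, x ∂F) * (h + excess F t - excess F (t - h))) atTop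
      (𝓝 (1 / (∫ x, x ∂F) * (h + 0 - 0))) :=
    ((tendsto_const_nhds.add hg).sub
      (hg.comp (tendsto_atTop_add_const_right _ _ tendsto_id))).const_mul _
  rw [add_zero, sub_zero] at h1
  refine ((ENNReal.continuous_ofReal.tendsto _).comp h1).congr' ?_
  filter_upwards [eventually_ge_atTop h] with t ht
  have hne := (renewalMeasure_Iic_lt_top hF t).ne
  have : (renewalMeasure F).real (Ioc (t - h) t)
      = renewalFunction F t - renewalFunction F (t - h) := by
    rw [show Ioc (t - h) t = Iic t \ Iic (t - h) by ext; simp [and_comm], measureReal_sdiff (Iic_subset_Iic.2 (by linarith)) measurableSet_Iic]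
    rfl
  have hfin : renewalMeasure F (Ioc (t - h) t) ≠ ∞ :=
    measure_ne_top_of_subset Ioc_subset_Iic_self hne
  rw [← ENNReal.ofReal_toReal hfin, ← measureReal_def, this]
  simp only [Function.comp]
  rw [excess_of_nonneg (hh.le.trans ht), excess_of_nonneg (sub_nonneg.2 ht)]
  congr 1
  field_simp
  ring

theorem integrable_max_shift (hF : F (Iic 0) = 0) (t : ℝ) :
    Integrable (fun x => max (t - x) 0) (renewalMeasure F) :=
  integrable_shift_of_bounded hF (f := fun x => max x 0) (by fun_prop)
    (fun x hx => by simp [hx.le]) (B := t) fun x hx => by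
      rw [max_eq_left hx.1, abs_of_nonneg hx.1]; exact hx.2

theorem integrable_indicator_Ici_shift (hF : F (Iic 0) = 0) (t : ℝ) :
    Integrable (fun x => (Ici (0 : ℝ)).indicator (1 : ℝ → ℝ) (t - x)) (renewalMeasure F) :=
  integrable_shift_of_bounded hF (measurable_one.indicator measurableSet_Ici)
    (fun x hx => by simp [indicator, hx]) (B := 1) fun x hx => by simp [indicator, hx.1]

omit [IsProbabilityMeasure F] in
theorem integral_indicator_Ici_shift (t : ℝ) :
    ∫ s, (Ici (0 : ℝ)).indicator (1 : ℝ → ℝ) (t - s) ∂(renewalMeasure F)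
      = renewalFunction F t := by
  rw [renewalFunction, ← integral_indicator_one measurableSet_Iic]
  congr 1; ext s; simp [indicator]

/-- Solve the renewal equation of x² on x ≥ 0: its forcing term is 2m x - m₂ plus a tail moment, and
convolution with U isolates the wanted integral. -/
theorem integral_max_shift (hF : F (Iic 0) = 0) (h3 : Integrable (fun x => x ^ 3) F) {t : ℝ}
    (ht : 0 ≤ t) :
    (∫ x, x ∂F) * ∫ s, max (t - s) 0 ∂(renewalMeasure F)
      = t ^ 2 / 2 + (∫ x, x ^ 2 ∂F) / 2 * renewalFunction F t
        - 1 / 2 * ∫ s, tailMoment F 0 2 (t - s) ∂(renewalMeasure F) := by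
  have hb : ∀ x ∈ Icc 0 t, |max x 0 ^ 2| ≤ t ^ 2 := fun x hx => by
    rw [max_eq_left hx.1, abs_of_nonneg (by positivity)]
    exact pow_le_pow_left₀ hx.1 hx.2 2
  have hsol := (eq_integral_renewalMeasure hF (φ := fun x => max x 0 ^ 2) (by fun_prop)
    (fun x hx => by simp [hx.le]) hb).2
  have hy : ∀ x : ℝ, max x 0 ^ 2 - ∫ τ, max (x - τ) 0 ^ 2 ∂F
      = 2 * (∫ x, x ∂F) * max x 0
        - (∫ x, x ^ 2 ∂F) * (Ici (0 : ℝ)).indicator (1 : ℝ → ℝ) x + tailMoment F 0 2 x := by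
    intro x
    rcases lt_or_ge x 0 with hx | hx
    · have : ∫ τ, max (x - τ) 0 ^ 2 ∂F = 0 := by
        refine integral_eq_zero_of_ae ?_
        filter_upwards [ae_pos hF] with τ hτ
        simp [show x - τ ≤ 0 by linarith]
      simp [this, tailMoment_of_neg hx, indicator, hx, hx.le]
    · rw [integral_max_sub_sq hF h3 hx, max_eq_left hx]
      simp [indicator, hx]; ring
  simp_rw [hy] at hsol
  have ha := integrable_max_shift hF t
  have h1 := integrable_indicator_Ici_shift hF t
  have hV := integral_indicator_Ici_shift (F := F) t
  rw [integral_sub_add_eq (ha.const_mul _) (h1.const_mul _)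
    (integrable_tailMoment_shift hF h3 (by norm_num) t), integral_const_mul, integral_const_mul, hV,
    max_eq_left ht] at hsol
  linarith

theorem mul_integral_renewalFunction_shift (hF : F (Iic 0) = 0) (t : ℝ) :
    (∫ x, x ∂F) * ∫ s, renewalFunction F (t - s) ∂(renewalMeasure F)
      = (∫ s, excess F (t - s) ∂(renewalMeasure F)) + (∫ s, max (t - s) 0 ∂(renewalMeasure F))
        + (∫ x, x ^ 2 ∂F) / (2 * ∫ x, x ∂F) * renewalFunction F t := by
  have ha := integrable_max_shift hF t
  have h1 := integrable_indicator_Ici_shift hF t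
  have hV := integral_indicator_Ici_shift (F := F) t
  have hVi : Integrable (fun s => renewalFunction F (t - s)) (renewalMeasure F) :=
    integrable_shift_of_bounded hF (measurable_renewalFunction hF)
      (fun x hx => renewalFunction_of_neg hF hx) (B := renewalFunction F t) fun x hx => by
        rw [abs_of_nonneg (renewalFunction_nonneg x)]; exact renewalFunction_mono hF hx.2
  simp_rw [excess_eq hF]
  rw [integral_sub_sub_eq (hVi.const_mul _) ha (h1.const_mul _),
    integral_const_mul, integral_const_mul, hV]
  ring

/-- Asymptotics of `2 U * U - V - V²` and hence of the variance of the counting process. -/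
theorem tendsto_renewal_variance (hF : F (Iic 0) = 0) (h3 : Integrable (fun x => x ^ 3) F)
    (hdri : DirectlyRiemannIntegrable (excess F)) {lam : ℝ} (hlam : lam = 1 / ∫ x, x ∂F) :
    Tendsto (fun t => 2 * (∫ s, renewalFunction F (t - s) ∂(renewalMeasure F))
        - renewalFunction F t - renewalFunction F t ^ 2
        - lam ^ 3 * ((∫ x, x ^ 2 ∂F) - (∫ x, x ∂F) ^ 2) * t) atTop
      (𝓝 (-(2 / 3) * lam ^ 3 * (∫ x, x ^ 3 ∂F) + 5 / 4 * lam ^ 4 * (∫ x, x ^ 2 ∂F) ^ 2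
        - 1 / 2 * lam ^ 2 * ∫ x, x ^ 2 ∂F)) := by
  have hm := mean_pos hF h3
  have hlam0 : 0 < lam := by rw [hlam]; positivity
  have hg := hdri.tendsto_zero
  have hi : Integrable (fun τ => τ) F := by
    simpa using integrable_pow_of_le_three hF h3 (k := 1) (by norm_num)
  have hU : ∀ h > 0, Tendsto (fun t => renewalMeasure F (Ioc (t - h) t)) atTop
      (𝓝 (ENNReal.ofReal (lam * h))) := fun h hh => by
    rw [hlam]; exact tendsto_renewalMeasure_Ioc hF h3 hg hh
  obtain ⟨⟨G, hG⟩, B, hB⟩ := hdri.exists_tendsto_integral_shift hlam0.le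
    (renewalMeasure_Iic_lt_top hF) hU (fun _ => excess_of_neg) (integrable_excess_shift hF)
  have hmeasH : Measurable fun t => ∫ s, excess F (t - s) ∂(renewalMeasure F) := by
    have := measurable_excess hF
    have h2 : Measurable fun p : ℝ × ℝ => excess F (p.1 - p.2) := by fun_prop
    exact (h2.stronglyMeasurable.integral_prod_right (ν := renewalMeasure F)).measurable
  have hDCT : Tendsto (fun t => ∫ x, x * ∫ s, excess F (t - x - s) ∂(renewalMeasure F) ∂F) atTop
      (𝓝 (∫ x, x * (lam * G) ∂F)) := by
    refine tendsto_integral_filter_of_dominated_convergence (fun x => |x| * B)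
      (Eventually.of_forall fun t => Measurable.aestronglyMeasurable (measurable_id.mul
        (hmeasH.comp (measurable_const.sub measurable_id)))) ?_ (hi.abs.mul_const B) ?_
    · refine Eventually.of_forall fun t => Eventually.of_forall fun x => ?_
      rw [norm_mul]
      exact mul_le_mul_of_nonneg_left (hB (t - x)) (norm_nonneg x)
    · exact Eventually.of_forall fun x =>
        (hG.comp (tendsto_atTop_add_const_right _ _ tendsto_id)).const_mul x
  rw [integral_mul_const] at hDCT
  have k11 := tendsto_integral_tailMoment_shift hF h3 hlam0.le hU (i := 1) (j := 1) (by norm_num)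
  have k02 := tendsto_integral_tailMoment_shift hF h3 hlam0.le hU (i := 0) (j := 2) (by norm_num)
  have k10 := tendsto_integral_tailMoment_shift hF h3 hlam0.le hU (i := 1) (j := 0) (by norm_num)
  have k01 := tendsto_integral_tailMoment_shift hF h3 hlam0.le hU (i := 0) (j := 1) (by norm_num)
  have htg := (((k11.sub k02).sub ((k10.sub k01).const_mul
    ((∫ x, x ^ 2 ∂F) / (2 * ∫ x, x ∂F)))).add hDCT).congr fun t => (mul_excess_eq hF h3 t).symm
  -- The limit of t g(t) must vanish; this is a linear equation for G, solved in `hGval`.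
  have hc := hdri.eq_zero_of_tendsto_mul htg
  rw [hc] at htg
  norm_num at hc k02
  set m := ∫ x, x ∂F with hm_def
  set m2 := ∫ x, x ^ 2 ∂F with hm2_def
  set m3 := ∫ x, x ^ 3 ∂F with hm3_def
  have hGval : G = (m2 / (2 * m)) ^ 2 - m3 / (6 * m) := by
    rw [hlam] at hc
    field_simp at hc ⊢
    linarith
  set r := m2 / (2 * m) with hr
  -- For t ≥ 0 this is exactly the centred variance after V = (g + t + r)/m is inserted; -2 t g(t)
  -- comes from V².
  have hlim : Tendsto (fun t => (1 / m ^ 2) * (2 * m * (∫ s, excess F (t - s) ∂(renewalMeasure F))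
      - (∫ s, tailMoment F 0 2 (t - s) ∂(renewalMeasure F)) + 3 * r ^ 2 - m * r
      + (2 * r - m) * excess F t - 2 * (t * excess F t) - excess F t ^ 2)) atTop
      (𝓝 ((1 / m ^ 2) * (2 * m * (lam * G) - lam * (m3 / 3) + 3 * r ^ 2 - m * r
        + (2 * r - m) * 0 - 2 * 0 - 0 ^ 2))) :=
    (((((((hG.const_mul (2 * m)).sub k02).add_const (3 * r ^ 2)).sub_const (m * r)).add
      (hg.const_mul (2 * r - m))).sub (htg.const_mul 2)).sub (hg.pow 2)).const_mul _
  have hval : (1 / m ^ 2) * (2 * m * (lam * G) - lam * (m3 / 3) + 3 * r ^ 2 - m * r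
        + (2 * r - m) * 0 - 2 * 0 - 0 ^ 2) = -(2 / 3) * lam ^ 3 * m3 + 5 / 4 * lam ^ 4 * m2 ^ 2
        - 1 / 2 * lam ^ 2 * m2 := by
    rw [hGval, hlam, hr]
    field_simp
    ring
  rw [hval] at hlim
  refine hlim.congr' ?_
  filter_upwards [eventually_ge_atTop 0] with t ht
  have e1 := mul_integral_renewalFunction_shift hF t
  have e2 := integral_max_shift hF h3 ht
  have e3 := excess_of_nonneg (F := F) ht
  rw [← hm_def, ← hm2_def] at e1 e2 e3
  rw [← hr] at e1 e3
  have hm2r : m2 = 2 * m * r := by rw [hr]; field_simp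
  rw [hm2r] at e2 ⊢
  generalize (∫ s, renewalFunction F (t - s) ∂(renewalMeasure F)) = W at *
  generalize (∫ s, excess F (t - s) ∂(renewalMeasure F)) = H at *
  generalize (∫ s, max (t - s) 0 ∂(renewalMeasure F)) = A at *
  generalize (∫ s, tailMoment F 0 2 (t - s) ∂(renewalMeasure F)) = K at *
  have hV : renewalFunction F t = (excess F t + t + r) / m := by rw [e3]; field_simp; ring
  rw [hV] at e1 e2 ⊢
  have hA : A = (t ^ 2 / 2 + 2 * m * r / 2 * ((excess F t + t + r) / m) - 1 / 2 * K) / m := by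
    rw [← e2]; field_simp
  have hW : W = (H + A + r * ((excess F t + t + r) / m)) / m := by rw [← e1]; field_simp
  rw [hW, hA, hlam]
  field_simp
  ring

end Excess

/-! ### From the random variables to the renewal measure. -/

section Bridge

variable {Ω : Type*} [MeasurableSpace Ω] {μ : Measure Ω} [IsProbabilityMeasure μ] {T : ℕ → Ω → ℝ}

theorem measurable_countingTime (hmeas : ∀ n, Measurable (T n)) (n : ℕ) :
    Measurable (countingTime T n) :=
  Finset.measurable_sum _ fun i _ => hmeas i

omit [IsProbabilityMeasure μ] in
theorem indepFun_countingTime (hmeas : ∀ n, Measurable (T n)) (hindep : iIndepFun T μ) (n : ℕ) :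
    IndepFun (countingTime T n) (T n) μ := by
  have := hindep.indepFun_finsetSum_of_notMem hmeas (s := Finset.range n) (i := n) (by simp)
  convert this using 1
  ext ω; simp [countingTime]

theorem map_countingTime (hmeas : ∀ n, Measurable (T n)) (hindep : iIndepFun T μ)
    (hident : ∀ n, IdentDistrib (T n) (T 0) μ μ) (n : ℕ) :
    μ.map (countingTime T n) = convPow (μ.map (T 0)) n := by
  induction n with
  | zero =>
    have : countingTime T 0 = fun _ => 0 := by ext ω; simp [countingTime]
    rw [this, Measure.map_const]; simp [convPow]
  | succ n ih =>
    have : countingTime T (n + 1) = countingTime T n + T n := by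
      ext ω; simp [countingTime, Finset.sum_range_succ]
    rw [this, (indepFun_countingTime hmeas hindep n).map_add_eq_map_conv_map
      (measurable_countingTime hmeas n) (hmeas n), ih, (hident n).map_eq, convPow]

theorem measure_countingTime_le (hmeas : ∀ n, Measurable (T n)) (hindep : iIndepFun T μ)
    (hident : ∀ n, IdentDistrib (T n) (T 0) μ μ) (t : ℝ) (n : ℕ) :
    μ {ω | countingTime T n ω ≤ t} = convPow (μ.map (T 0)) n (Iic t) := by
  rw [← map_countingTime hmeas hindep hident,
    Measure.map_apply (measurable_countingTime hmeas n) measurableSet_Iic]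
  rfl

omit [IsProbabilityMeasure μ] in
theorem ae_forall_pos (hident : ∀ n, IdentDistrib (T n) (T 0) μ μ) (hpos : ∀ᵐ ω ∂μ, 0 < T 0 ω) :
    ∀ᵐ ω ∂μ, ∀ n, 0 < T n ω :=
  ae_all_iff.2 fun n => (hident n).symm.ae_snd (p := fun x => 0 < x) measurableSet_Ioi hpos

omit [IsProbabilityMeasure μ] in
theorem map_Iic_zero (hmeas : Measurable (T 0)) (hpos : ∀ᵐ ω ∂μ, 0 < T 0 ω) :
    μ.map (T 0) (Iic 0) = 0 := by
  rw [Measure.map_apply hmeas measurableSet_Iic]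
  rw [ae_iff] at hpos
  convert hpos using 2; ext; simp

/-- A finite lower set of naturals is an initial segment, hence determined by its cardinality. -/
theorem mem_iff_lt_ncard_of_finite {A : Set ℕ} (hA : A.Finite) (hlow : IsLowerSet A) (n : ℕ) :
    n ∈ A ↔ n < A.ncard := by
  classical
  have hex : ∃ k, k ∉ A := hA.exists_notMem
  have hAe : A = Iio (Nat.find hex) := by
    ext k
    refine ⟨fun hk => ?_, fun hk => not_not.1 (Nat.find_min hex hk)⟩
    by_contra hlt
    exact Nat.find_spec hex (hlow (not_lt.1 hlt) hk)
  have hc : A.ncard = Nat.find hex := by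
    conv_lhs => rw [hAe]
    rw [← Finset.coe_Iio, ncard_coe_finset]
    simp
  rw [hc]
  conv_lhs => rw [hAe]
  rfl

/-- Almost surely `tₙ ≤ t` exactly when `n < N(t)`. -/
theorem ae_countingTime_le_iff (hmeas : ∀ n, Measurable (T n)) (hindep : iIndepFun T μ)
    (hident : ∀ n, IdentDistrib (T n) (T 0) μ μ) (hpos : ∀ᵐ ω ∂μ, 0 < T 0 ω) (t : ℝ) :
    ∀ᵐ ω ∂μ, ∀ n, countingTime T n ω ≤ t ↔ n < countingProcess T t ω := by
  have : IsProbabilityMeasure (μ.map (T 0)) :=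
    Measure.isProbabilityMeasure_map (hmeas 0).aemeasurable
  -- Borel–Cantelli: the sum is V(t) < ∞, so almost surely only finitely many tₙ are at most t.
  have hfin : ∑' n, μ {ω | countingTime T n ω ≤ t} ≠ ∞ := by
    simp_rw [measure_countingTime_le hmeas hindep hident]
    rw [← Measure.sum_apply _ measurableSet_Iic]
    exact (renewalMeasure_Iic_lt_top (map_Iic_zero (hmeas 0) hpos) t).ne
  filter_upwards [ae_finite_setOfPred_mem hfin, ae_forall_pos hident hpos] with ω hω hp n
  refine mem_iff_lt_ncard_of_finite (A := {n | countingTime T n ω ≤ t}) hω ?_ n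
  intro a b hba ha
  refine le_trans ?_ (show countingTime T a ω ≤ t from ha)
  exact Finset.sum_le_sum_of_subset_of_nonneg (Finset.range_mono hba) fun i _ _ => (hp i).le

theorem tsum_ite_lt (a : ℕ → ℝ≥0∞) (N : ℕ) :
    ∑' n, (if n < N then a n else 0) = ∑ n ∈ Finset.range N, a n := by
  rw [tsum_eq_sum (s := Finset.range N) (fun n hn => by
    simp [show ¬ n < N by simpa using hn])]
  exact Finset.sum_congr rfl fun n hn => by simp [Finset.mem_range.1 hn]

/-- Random sums up to `N(t)` as series of indicators. -/
theorem ae_sum_range_countingProcess_eq (hmeas : ∀ n, Measurable (T n)) (hindep : iIndepFun T μ)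
    (hident : ∀ n, IdentDistrib (T n) (T 0) μ μ) (hpos : ∀ᵐ ω ∂μ, 0 < T 0 ω) (t : ℝ)
    (a : ℕ → Ω → ℝ≥0∞) :
    (fun ω => ∑ n ∈ Finset.range (countingProcess T t ω), a n ω)
      =ᵐ[μ] fun ω => ∑' n, a n ω * {ω | countingTime T n ω ≤ t}.indicator 1 ω := by
  filter_upwards [ae_countingTime_le_iff hmeas hindep hident hpos t] with ω hω
  rw [← tsum_ite_lt]
  refine tsum_congr fun n => ?_
  by_cases h : n < countingProcess T t ω
  · simp [h, indicator, (hω n).2 h]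
  · simp [h, indicator, (hω n).not.2 h]

theorem aemeasurable_sum_range_countingProcess (hmeas : ∀ n, Measurable (T n))
    (hindep : iIndepFun T μ) (hident : ∀ n, IdentDistrib (T n) (T 0) μ μ)
    (hpos : ∀ᵐ ω ∂μ, 0 < T 0 ω) (t : ℝ) {a : ℕ → Ω → ℝ≥0∞} (ha : ∀ n, Measurable (a n)) :
    AEMeasurable (fun ω => ∑ n ∈ Finset.range (countingProcess T t ω), a n ω) μ := by
  refine AEMeasurable.congr (Measurable.aemeasurable ?_)
    (ae_sum_range_countingProcess_eq hmeas hindep hident hpos t a).symm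
  exact Measurable.tsum fun n => (ha n).mul
    (measurable_one.indicator (measurableSet_le (measurable_countingTime hmeas n) measurable_const))

/-- Wald's argument: n < N(t) means tₙ ≤ t, which involves only `T 0`, …, `T (n - 1)` and is
independent of `T n`. The summands 1, 2(n+1) and x give E[N], E[N(N+1)] and E[t_{N(t)}]. -/
theorem lintegral_sum_range_countingProcess (hmeas : ∀ n, Measurable (T n))
    (hindep : iIndepFun T μ) (hident : ∀ n, IdentDistrib (T n) (T 0) μ μ)
    (hpos : ∀ᵐ ω ∂μ, 0 < T 0 ω) (t : ℝ) {a : ℝ → ℕ → ℝ≥0∞} (ha : ∀ n, Measurable fun x => a x n) :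
    ∫⁻ ω, ∑ n ∈ Finset.range (countingProcess T t ω), a (T n ω) n ∂μ
      = ∑' n, (∫⁻ ω, a (T 0 ω) n ∂μ) * convPow (μ.map (T 0)) n (Iic t) := by
  rw [lintegral_congr_ae (ae_sum_range_countingProcess_eq hmeas hindep hident hpos t
    fun n ω => a (T n ω) n)]
  have hms : ∀ n, MeasurableSet {ω | countingTime T n ω ≤ t} := fun n =>
    measurableSet_le (measurable_countingTime hmeas n) measurable_const
  have hterm : ∀ n, AEMeasurable
      (fun ω => a (T n ω) n * {ω | countingTime T n ω ≤ t}.indicator 1 ω) μ := fun n =>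
    (((ha n).comp (hmeas n)).mul (measurable_one.indicator (hms n))).aemeasurable
  rw [lintegral_tsum hterm]
  refine tsum_congr fun n => ?_
  have hind : IndepFun (fun ω => a (T n ω) n)
      ({ω | countingTime T n ω ≤ t}.indicator (1 : Ω → ℝ≥0∞)) μ := by
    have h1 : Measurable ((Iic t).indicator (1 : ℝ → ℝ≥0∞)) :=
      measurable_one.indicator measurableSet_Iic
    exact (indepFun_countingTime hmeas hindep n).symm.comp (ha n) h1
  rw [← measure_countingTime_le hmeas hindep hident, ← lintegral_indicator_one (hms n)]
  refine (lintegral_mul_eq_lintegral_mul_lintegral_of_indepFun ((ha n).comp (hmeas n))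
    (measurable_one.indicator (hms n)) hind).trans ?_
  congr 1
  exact ((hident n).comp (ha n)).lintegral_eq

/-- U*U is a Cauchy product: `F^{*n}` arises from the n + 1 pairs with sum n. -/
theorem tsum_succ_mul_convPow (F : Measure ℝ) [IsProbabilityMeasure F] (t : ℝ) :
    ∑' n : ℕ, ((n : ℝ≥0∞) + 1) * convPow F n (Iic t)
      = ∫⁻ s, renewalMeasure F (Iic (t - s)) ∂(renewalMeasure F) := by
  have hmc : ∀ k : ℕ, Measurable fun s => convPow F k (Iic (t - s)) := by
    intro k
    have : Antitone fun s => convPow F k (Iic (t - s)) := fun x y hxy =>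
      measure_mono (Iic_subset_Iic.2 (by linarith))
    exact this.measurable
  have hconv : ∀ m k : ℕ, ∫⁻ s, convPow F k (Iic (t - s)) ∂(convPow F m)
      = convPow F (m + k) (Iic t) := by
    intro m k
    rw [convPow_add, ← lintegral_indicator_one measurableSet_Iic,
      Measure.lintegral_conv (measurable_one.indicator measurableSet_Iic)]
    refine lintegral_congr fun s => ?_
    rw [← lintegral_indicator_one measurableSet_Iic]
    refine lintegral_congr fun x => ?_
    simp [indicator, le_sub_iff_add_le']
  have hU : ∀ s, renewalMeasure F (Iic (t - s)) = ∑' k, convPow F k (Iic (t - s)) := fun s =>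
    Measure.sum_apply _ measurableSet_Iic
  simp_rw [hU]
  rw [renewalMeasure, lintegral_sum_measure]
  simp_rw [lintegral_tsum fun k => (hmc k).aemeasurable, hconv]
  rw [← ENNReal.tsum_prod (f := fun m k => convPow F (m + k) (Iic t)),
    ← Finset.HasAntidiagonal.sigmaAntidiagonalEquivProd.tsum_eq, ENNReal.tsum_sigma']
  refine tsum_congr fun n => ?_
  rw [tsum_fintype]
  have : ∀ b : Finset.HasAntidiagonal.antidiagonal n, convPow F
      ((Finset.HasAntidiagonal.sigmaAntidiagonalEquivProd ⟨n, b⟩).1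
        + (Finset.HasAntidiagonal.sigmaAntidiagonalEquivProd ⟨n, b⟩).2)
      (Iic t) = convPow F n (Iic t) := by
    rintro ⟨b, hb⟩
    simp [Finset.HasAntidiagonal.sigmaAntidiagonalEquivProd,
      Finset.HasAntidiagonal.mem_antidiagonal.1 hb]
  simp_rw [this]
  simp

-- Moments are computed in `ℝ≥0∞`, and the a.e. measurability of f is inherited from g.
omit [IsProbabilityMeasure μ] in
theorem integrable_and_integral_of_lintegral {f : Ω → ℝ} {g : Ω → ℝ≥0∞} (hf : 0 ≤ᵐ[μ] f)
    (hg : AEMeasurable g μ) (hfg : ∀ᵐ ω ∂μ, g ω = ENNReal.ofReal (f ω)) {c : ℝ≥0∞} (hc : c ≠ ∞)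
    (hint : ∫⁻ ω, g ω ∂μ = c) : Integrable f μ ∧ ∫ ω, f ω ∂μ = c.toReal := by
  have hm : AEMeasurable f μ := by
    refine hg.ennreal_toReal.congr ?_
    filter_upwards [hf, hfg] with ω h0 h1
    rw [h1, ENNReal.toReal_ofReal h0]
  have he : ∫⁻ ω, ENNReal.ofReal (f ω) ∂μ = c := by
    rw [← hint]; exact lintegral_congr_ae (hfg.mono fun ω h => h.symm)
  refine ⟨⟨hm.aestronglyMeasurable, ?_⟩, ?_⟩
  · rw [hasFiniteIntegral_iff_ofReal hf, he]; exact hc.lt_top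
  · rw [integral_eq_lintegral_of_nonneg_ae hf hm.aestronglyMeasurable, he]

theorem integral_countingProcess (hmeas : ∀ n, Measurable (T n))
    (hindep : iIndepFun T μ) (hident : ∀ n, IdentDistrib (T n) (T 0) μ μ)
    (hpos : ∀ᵐ ω ∂μ, 0 < T 0 ω) (t : ℝ) :
    Integrable (fun ω => (countingProcess T t ω : ℝ)) μ ∧
      ∫ ω, (countingProcess T t ω : ℝ) ∂μ = renewalFunction (μ.map (T 0)) t := by
  have : IsProbabilityMeasure (μ.map (T 0)) :=
    Measure.isProbabilityMeasure_map (hmeas 0).aemeasurable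
  refine integrable_and_integral_of_lintegral (Eventually.of_forall fun ω => Nat.cast_nonneg _)
    (aemeasurable_sum_range_countingProcess hmeas hindep hident hpos t
      (a := fun _ _ => 1) fun _ => measurable_const)
    (Eventually.of_forall fun ω => by simp)
    (renewalMeasure_Iic_lt_top (map_Iic_zero (hmeas 0) hpos) t).ne ?_
  rw [lintegral_sum_range_countingProcess hmeas hindep hident hpos t (a := fun _ _ => 1)
    fun _ => measurable_const, renewalMeasure, Measure.sum_apply _ measurableSet_Iic]
  simp

theorem integral_countingProcess_mul_succ (hmeas : ∀ n, Measurable (T n))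
    (hindep : iIndepFun T μ) (hident : ∀ n, IdentDistrib (T n) (T 0) μ μ)
    (hpos : ∀ᵐ ω ∂μ, 0 < T 0 ω) (t : ℝ) :
    Integrable (fun ω => (countingProcess T t ω : ℝ) * (countingProcess T t ω + 1)) μ ∧
      ∫ ω, (countingProcess T t ω : ℝ) * (countingProcess T t ω + 1) ∂μ
        = 2 * ∫ s, renewalFunction (μ.map (T 0)) (t - s) ∂(renewalMeasure (μ.map (T 0))) := by
  have : IsProbabilityMeasure (μ.map (T 0)) :=
    Measure.isProbabilityMeasure_map (hmeas 0).aemeasurable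
  set F := μ.map (T 0) with hFdef
  have hF : F (Iic 0) = 0 := map_Iic_zero (hmeas 0) hpos
  have hVi : Integrable (fun s => renewalFunction F (t - s)) (renewalMeasure F) :=
    integrable_shift_of_bounded hF (measurable_renewalFunction hF)
      (fun x hx => renewalFunction_of_neg hF hx) (B := renewalFunction F t) fun x hx => by
        rw [abs_of_nonneg (renewalFunction_nonneg x)]; exact renewalFunction_mono hF hx.2
  have hW : ∫⁻ s, renewalMeasure F (Iic (t - s)) ∂(renewalMeasure F)
      = ENNReal.ofReal (∫ s, renewalFunction F (t - s) ∂(renewalMeasure F)) := by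
    rw [ofReal_integral_eq_lintegral_ofReal hVi
      (Eventually.of_forall fun s => renewalFunction_nonneg _)]
    refine lintegral_congr fun s => ?_
    rw [renewalFunction, measureReal_def, ENNReal.ofReal_toReal (renewalMeasure_Iic_lt_top hF _).ne]
  have hW0 : 0 ≤ ∫ s, renewalFunction F (t - s) ∂(renewalMeasure F) :=
    integral_nonneg fun s => renewalFunction_nonneg _
  -- The weights 2(n+1) are chosen to sum to N(N+1).
  have hsum : ∀ N : ℕ, ∑ n ∈ Finset.range N, (2 * ((n : ℝ≥0∞) + 1)) = N * (N + 1) := by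
    intro N
    induction N with
    | zero => simp
    | succ N ih => rw [Finset.sum_range_succ, ih]; push_cast; ring
  have h := integrable_and_integral_of_lintegral (μ := μ)
    (f := fun ω => (countingProcess T t ω : ℝ) * (countingProcess T t ω + 1))
    (Eventually.of_forall fun ω => by dsimp; positivity)
    (aemeasurable_sum_range_countingProcess hmeas hindep hident hpos t
      (a := fun n _ => 2 * ((n : ℝ≥0∞) + 1)) fun _ => measurable_const)
    (Eventually.of_forall fun ω => by
      rw [hsum, ENNReal.ofReal_mul (by positivity), ENNReal.ofReal_add (by positivity) zero_le_one]
      simp)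
    (c := ENNReal.ofReal (2 * ∫ s, renewalFunction F (t - s) ∂(renewalMeasure F)))
    ENNReal.ofReal_ne_top (by
      rw [lintegral_sum_range_countingProcess hmeas hindep hident hpos t
        (a := fun _ n => 2 * ((n : ℝ≥0∞) + 1)) fun _ => measurable_const,
        ENNReal.ofReal_mul zero_le_two, ← hW, ← tsum_succ_mul_convPow, ← ENNReal.tsum_mul_left]
      simp [mul_assoc, hFdef])
  rwa [ENNReal.toReal_ofReal (by positivity)] at h

/-- Wald's identity for the residual time. -/
theorem integral_residualTime (hmeas : ∀ n, Measurable (T n))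
    (hindep : iIndepFun T μ) (hident : ∀ n, IdentDistrib (T n) (T 0) μ μ)
    (hpos : ∀ᵐ ω ∂μ, 0 < T 0 ω) (hint : Integrable (T 0) μ) (t : ℝ) :
    ∫ ω, residualTime T t ω ∂μ = (∫ ω, T 0 ω ∂μ) * renewalFunction (μ.map (T 0)) t - t := by
  have : IsProbabilityMeasure (μ.map (T 0)) :=
    Measure.isProbabilityMeasure_map (hmeas 0).aemeasurable
  have hF := map_Iic_zero (hmeas 0) hpos
  have hm0 : 0 ≤ ∫ ω, T 0 ω ∂μ := integral_nonneg_of_ae (hpos.mono fun _ h => h.le)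
  have hp := ae_forall_pos hident hpos
  have h := integrable_and_integral_of_lintegral (μ := μ)
    (f := fun ω => countingTime T (countingProcess T t ω) ω)
    (hp.mono fun ω h => Finset.sum_nonneg fun i _ => (h i).le)
    (aemeasurable_sum_range_countingProcess hmeas hindep hident hpos t
      (a := fun n ω => ENNReal.ofReal (T n ω)) fun n => (hmeas n).ennreal_ofReal)
    (hp.mono fun ω h => (ENNReal.ofReal_sum_of_nonneg fun i _ => (h i).le).symm)
    (c := ENNReal.ofReal (∫ ω, T 0 ω ∂μ) * renewalMeasure (μ.map (T 0)) (Iic t))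
    (ENNReal.mul_ne_top ENNReal.ofReal_ne_top (renewalMeasure_Iic_lt_top hF t).ne) (by
      rw [lintegral_sum_range_countingProcess hmeas hindep hident hpos t
        (a := fun x _ => ENNReal.ofReal x) fun _ => ENNReal.measurable_ofReal,
        ENNReal.tsum_mul_left, renewalMeasure, Measure.sum_apply _ measurableSet_Iic,
        ofReal_integral_eq_lintegral_ofReal hint (hpos.mono fun _ h => h.le)])
  simp only [residualTime]
  rw [integral_sub h.1 (integrable_const t), h.2, ENNReal.toReal_mul, ENNReal.toReal_ofReal hm0]
  simp [renewalFunction, measureReal_def]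

end Bridge

end Renewal

/-! ### The variance of the counting process. -/

theorem proposition4p2 {Ω : Type*} [MeasurableSpace Ω] (μ : Measure Ω) [IsProbabilityMeasure μ]
    (T : ℕ → Ω → ℝ)
    (hmeas : ∀ n, Measurable (T n))
    (hindep : iIndepFun T μ)
    (hident : ∀ n, IdentDistrib (T n) (T 0) μ μ)
    (hpos : ∀ᵐ ω ∂μ, 0 < T 0 ω)
    (hthird : Integrable (fun ω => T 0 ω ^ 3) μ)
    (lam : ℝ) (hlam : lam = 1 / ∫ ω, T 0 ω ∂μ)
    (hdri : Renewal.DirectlyRiemannIntegrable (fun t =>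
      (∫ ω, Renewal.residualTime T t ω ∂μ) - 1 / 2 * lam * ∫ ω, T 0 ω ^ 2 ∂μ)) :
    (∀ t : ℝ, 0 ≤ t → MemLp (fun ω => (Renewal.countingProcess T t ω : ℝ)) 2 μ) ∧
    Tendsto
      (fun t : ℝ =>
        variance (fun ω => (Renewal.countingProcess T t ω : ℝ)) μ
          - lam ^ 3 * variance (T 0) μ * t)
      atTop
      (𝓝 (-(2 / 3) * lam ^ 3 * (∫ ω, T 0 ω ^ 3 ∂μ)
        + 5 / 4 * lam ^ 4 * (∫ ω, T 0 ω ^ 2 ∂μ) ^ 2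
        - 1 / 2 * lam ^ 2 * ∫ ω, T 0 ω ^ 2 ∂μ)) := by
  have : IsProbabilityMeasure (μ.map (T 0)) :=
    Measure.isProbabilityMeasure_map (hmeas 0).aemeasurable
  have hF := Renewal.map_Iic_zero (hmeas 0) hpos
  have hmap : ∀ k : ℕ, ∫ x, x ^ k ∂(μ.map (T 0)) = ∫ ω, T 0 ω ^ k ∂μ := fun k =>
    integral_map (hmeas 0).aemeasurable (by fun_prop)
  have hmap1 : ∫ x, x ∂(μ.map (T 0)) = ∫ ω, T 0 ω ∂μ := by simpa using hmap 1
  have h3 : Integrable (fun x : ℝ => x ^ 3) (μ.map (T 0)) :=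
    (integrable_map_measure (by fun_prop) (hmeas 0).aemeasurable).2 hthird
  have hpow : ∀ k ≤ 3, Integrable (fun ω => T 0 ω ^ k) μ := fun k hk =>
    (Renewal.integrable_pow_of_le_three hF h3 hk).comp_measurable (hmeas 0)
  have hint : Integrable (T 0) μ := by simpa using hpow 1 (by norm_num)
  have hN := Renewal.integral_countingProcess hmeas hindep hident hpos
  have hNN := Renewal.integral_countingProcess_mul_succ hmeas hindep hident hpos
  have hsq : ∀ t, (fun ω => (Renewal.countingProcess T t ω : ℝ) ^ 2)
      = fun ω => (Renewal.countingProcess T t ω : ℝ) * (Renewal.countingProcess T t ω + 1)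
        - Renewal.countingProcess T t ω := by
    intro t; ext ω; ring
  have hL2 : ∀ t, MemLp (fun ω => (Renewal.countingProcess T t ω : ℝ)) 2 μ := by
    intro t
    rw [memLp_two_iff_integrable_sq (hN t).1.aestronglyMeasurable, hsq]
    exact (hNN t).1.sub (hN t).1
  refine ⟨fun t _ => hL2 t, ?_⟩
  -- By Wald's identity and λ = 1/m, the given function equals g on [0, ∞).
  have hdri' : Renewal.DirectlyRiemannIntegrable (Renewal.excess (μ.map (T 0))) := by
    refine hdri.congr fun t ht => ?_
    rw [Renewal.excess_of_nonneg ht, Renewal.integral_residualTime hmeas hindep hident hpos hint,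
      hmap, hmap1, hlam]
    ring
  have hmain := Renewal.tendsto_renewal_variance hF h3 hdri' (lam := lam) (by rw [hmap1, hlam])
  rw [hmap, hmap, hmap1] at hmain
  have hTvar : variance (T 0) μ = (∫ ω, T 0 ω ^ 2 ∂μ) - (∫ ω, T 0 ω ∂μ) ^ 2 :=
    variance_eq_sub ((memLp_two_iff_integrable_sq hint.aestronglyMeasurable).2
      (hpow 2 (by norm_num)))
  refine hmain.congr fun t => ?_
  have hVar : variance (fun ω => (Renewal.countingProcess T t ω : ℝ)) μ
      = (∫ ω, (Renewal.countingProcess T t ω : ℝ) ^ 2 ∂μ)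
        - (∫ ω, (Renewal.countingProcess T t ω : ℝ) ∂μ) ^ 2 :=
    variance_eq_sub (hL2 t)
  rw [hVar, hTvar, hsq, integral_sub (hNN t).1 (hN t).1, (hNN t).2, (hN t).2]
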